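/- Let $I=\{1,\dots,n\}$, let $I^*=\{1^*,\dots,n^*\}$, $J=I\sqcup I^*$ with the involution $*$, and let $J_n$ be the collection of admissible $n$-subsets of $J$ (those $B$ with $B\cap B^*=\emptyset$, $\#B=n$). Let $C$ be a real $n\times 2n$ matrix with columns indexed by $J$ whose rows are a basis of a totally isotropic subspace of $\mathbb R^J$ for the symmetric bilinear form with $e_i\cdot e_{i^*}=1$ for $i\in I$ and $e_x\cdot e_y=0$ for $y\neq x^*$. Let $M\subseteq J_n$ be the collection of those $B\in J_n$ for which the $n\times n$ minor of $C$ on the columns $B$ is non-zero (so $C$ is an orthogonal representation of $M$). For $F\in M$ put $T=F\cap I$. Swap columns $j$ and $j^*$ of $C$ for every $j\in T$, and reduce by row operations to the form $(A',\mathrm{Id}_n)$, the columns in the places of $I$ being on the left and those in the places of $I^*$ on the right. Put $\varepsilon_0=1$, and for $i=1,\dots,n$ put $\varepsilon_i=\varepsilon_{i-1}$ if $i\notin T$ and $\varepsilon_i=-\varepsilon_{i-1}$ if $i\in T$. Set $a_{ij}=\varepsilon_i\varepsilon_j a'_{ij}$ and $A=(a_{ij})$. For $B\in J_n$ let $p_F(B)\in\{+1,-1,0\}$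 be the sign of the Pfaffian of the principal submatrix of $A$ indexed by $(B\mathbin\Delta F)\cap I$ (with rows and columns in increasing order; the Pfaffian is $1$ for the empty index set and $0$ for an index set of odd size). A map $p:J_n\to\{+1,-1,0\}$ is called an oriented orthogonal matroid (with $p$ and $-p$ identified) if the following two conditions hold. (1) $\{B: p(B)\ne 0\}$ is a Lagrangian orthogonal matroid, that is, for every $D_n$-admissible ordering of $J$ (a partial ordering $a_1\prec\dots\prec a_{n-1}\prec\{a_n,a_n^*\}\prec a_{n-1}^*\prec\dots\prec a_1^*$ with $\{a_1,\dots,a_n\}$ admissible and $a_n,a_n^*$ incomparable) it contains a member $B$ such that $A\preceq B$ in the induced Gale ordering for every member $A$; here $A\preceq B$ means that, when both sets are listed in increasing order, each element of $A$ is $\preceq$ the corresponding element of $B$. (2) The map $p':2^I\to\{+1,-1,0\}$ given by $p'(S)=p(S\cup (I\setminus S)^*)$ is an oriented even $\Delta$-matroid, that is: $p'$ is not identically zero; $p'(A)\neq0\neq p'(B)$ implies $\#A\equiv\#B \pmod 2$; and whenever $A,B\subseteq I$, $A\mathbin\Delta B=\{i_1<\dots<i_l\}$ and $w\in\{+1,-1\}$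 are such that $\kappa_j=w(-1)^jp'(A\mathbin\Delta\{i_j\})\,p'(B\mathbin\Delta\{i_j\})\ge0$ for all $1\le j\le l$, then $\kappa_j=0$ for all $j$. Then $M$ is non-empty; for every $F\in M$ the reduction above is possible, $A'$ and $A$ are skew-symmetric, and $p_F$ is an oriented orthogonal matroid with $\{B:p_F(B)\neq0\}=M$. Moreover it is independent of the choice of $F$: for all $F,F'\in M$, either $p_{F'}=p_F$ or $p_{F'}=-p_F$. -/

import Mathlib

namespace OrthMat

open Finset

/-- The ground set `J = I ⊔ I*` with `I = Fin n` (the label `i` of `{1, …, n}` is the element `i - 1`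
of `Fin n`); `Sum.inl i` is the unstarred element `i`, `Sum.inr i` is the starred element `i*`. -/
abbrev Ground (n : ℕ) : Type := Fin n ⊕ Fin n

/-- The involution `*` on `J`. -/
def star {n : ℕ} (x : Ground n) : Ground n := x.swap

/-- A set `A ⊆ J` is admissible if `A ∩ A* = ∅`. -/
def Admissible {n : ℕ} (A : Finset (Ground n)) : Prop := Disjoint A (A.image star)

/-- `J_k`: the admissible `k`-element subsets of `J`. -/
def AdmSet (n k : ℕ) : Type := {A : Finset (Ground n) // A.card = k ∧ Admissible A}

/-! ### Orthogonal matroids -/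

/-- The `D_n`-admissible ordering `a_1 ≺ ⋯ ≺ a_{n-1} ≺ {a_n, a_n*} ≺ a_{n-1}* ≺ ⋯ ≺ a_1*`
(non-strict version), in which `a_n` and `a_n*` are incomparable. -/
def dnLE {n : ℕ} (a : Fin n → Ground n) (x y : Ground n) : Prop :=
  x = y ∨
  (∃ i j, i < j ∧ x = a i ∧ y = a j) ∨
  (∃ i j, i < j ∧ x = star (a j) ∧ y = star (a i)) ∨
  (∃ i j, ¬ (i.val + 1 = n ∧ j.val + 1 = n) ∧ x = a i ∧ y = star (a j))

/-- A relation `r` (thought of as `≼`) is a `D_n`-admissible ordering of `J`. -/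
def IsDnAdmissible {n : ℕ} (r : Ground n → Ground n → Prop) : Prop :=
  ∃ a : Fin n → Ground n, Function.Injective a ∧ Admissible (univ.image a) ∧
    ∀ x y, r x y ↔ dnLE a x y

/-- `f` lists the elements of `A` in strictly increasing order for `r`. -/
def IsIncreasingList {n k : ℕ} (r : Ground n → Ground n → Prop) (A : Finset (Ground n))
    (f : Fin k → Ground n) : Prop :=
  univ.image f = A ∧ ∀ i j, i < j → r (f i) (f j) ∧ f i ≠ f j

/-- The Gale ordering on `J_k` induced by `r`. -/
def galeLE {n k : ℕ} (r : Ground n → Ground n → Prop) (A B : AdmSet n k) : Prop :=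
  ∃ f g : Fin k → Ground n, IsIncreasingList r A.1 f ∧ IsIncreasingList r B.1 g ∧
    ∀ i, r (f i) (g i)

/-- A collection `𝓑 ⊆ J_k` is an orthogonal matroid of rank `k`: every `D_n`-admissible ordering
has a Gale-maximum in `𝓑`. It is Lagrangian if `k = n`. -/
def IsOrthogonalMatroid {n k : ℕ} (𝓑 : Set (AdmSet n k)) : Prop :=
  ∀ r : Ground n → Ground n → Prop, IsDnAdmissible r → ∃ B ∈ 𝓑, ∀ A ∈ 𝓑, galeLE r A B

/-! ### Oriented even Δ-matroids and oriented orthogonal matroids -/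

/-- `κ_j = w (-1)^j p(A Δ {i_j}) p(B Δ {i_j})`, where `A Δ B = {i_1 < ⋯ < i_l}`.
The index `j ∈ {1, …, l}` is `j.val + 1` for `j : Fin l`. -/
def kappa {n : ℕ} (p : Finset (Fin n) → SignType) (A B : Finset (Fin n)) (w : SignType)
    (j : Fin (symmDiff A B).card) : SignType :=
  w * (-1) ^ (j.val + 1) * p (symmDiff A {(symmDiff A B).orderEmbOfFin rfl j}) *
    p (symmDiff B {(symmDiff A B).orderEmbOfFin rfl j})

/-- A map `p : 2^I → {+1, -1, 0}` is (a representative of) an oriented even Δ-matroid. -/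
structure IsOrientedEvenDeltaMatroid {n : ℕ} (p : Finset (Fin n) → SignType) : Prop where
  nonzero : ∃ A, p A ≠ 0
  even : ∀ A B, p A ≠ 0 → p B ≠ 0 → A.card ≡ B.card [MOD 2]
  exchange : ∀ (A B : Finset (Fin n)) (w : SignType), w = 1 ∨ w = -1 →
    (∀ j, 0 ≤ kappa p A B w j) → ∀ j, kappa p A B w j = 0

/-- `B ∩ I`, for a subset `B` of `J`. -/
def unstarred {n : ℕ} (B : Finset (Ground n)) : Finset (Fin n) :=
  univ.filter fun i => Sum.inl i ∈ B

/-- The element `A ∪ (I ∖ A)*` of `J_n`, for `A ⊆ I`. -/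
def complete {n : ℕ} (A : Finset (Fin n)) : AdmSet n n :=
  ⟨A.disjSum Aᶜ, by
    refine ⟨by simp [Finset.card_disjSum, Finset.card_compl, Nat.add_sub_cancel'
      (by simpa using Finset.card_le_univ A : A.card ≤ n)], ?_⟩
    rw [Admissible, Finset.disjoint_left]
    rintro (x | x) h h' <;> simp [star] at h h'
    · exact h' h
    · exact h h'⟩

/-- `complete A` is the unique element `B` of `J_n` with `B ∩ I = A`. -/
theorem unstarred_eq_iff {n : ℕ} (A : Finset (Fin n)) (B : AdmSet n n) :
    unstarred B.1 = A ↔ B = complete A := by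
  constructor
  · rintro rfl
    obtain ⟨B, hc, ha⟩ := B
    apply Subtype.ext
    refine Finset.eq_of_subset_of_card_le ?_ (by rw [(complete _).2.1, hc])
    rintro (x | x) h
    · simpa [complete, unstarred] using h
    · simp only [complete, unstarred, Finset.inr_mem_disjSum, Finset.mem_compl,
        Finset.mem_filter, Finset.mem_univ, true_and]
      intro h'
      exact Finset.disjoint_left.1 ha h (Finset.mem_image.2 ⟨_, h', rfl⟩)
  · rintro rfl
    ext i
    simp [complete, unstarred]

/-- The map `p' : 2^I → {+, -, 0}` obtained from `p : J_n → {+, -, 0}` by ignoring starred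
elements. -/
def forgetStars {n : ℕ} (p : AdmSet n n → SignType) (A : Finset (Fin n)) : SignType :=
  p (complete A)

/-- A map `p : J_n → {+, -, 0}` is (a representative of) an oriented orthogonal matroid: its
support is a Lagrangian orthogonal matroid, and `p'` is an oriented even Δ-matroid. -/
structure IsOrientedOrthogonalMatroid {n : ℕ} (p : AdmSet n n → SignType) : Prop where
  orthogonal : IsOrthogonalMatroid {A : AdmSet n n | p A ≠ 0}
  oriented : IsOrientedEvenDeltaMatroid (forgetStars p)

/-- The equivalence `p ∼ -p` of sign maps. -/
def SignEquivalent {n : ℕ} (p q : AdmSet n n → SignType) : Prop :=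
  (∀ B, q B = p B) ∨ (∀ B, q B = -p B)

/-! ### Orthogonal representations -/

/-- The symmetric bilinear form on `ℝ^J` with `e_i · e_{i*} = 1` and `e_x · e_y = 0` for
`y ≠ x*`. -/
def orthForm {n : ℕ} (u v : Ground n → ℝ) : ℝ := ∑ x, u x * v (star x)

/-- The admissible sets of `n` columns of `C` whose `n × n` minor is non-zero (whether the minor
vanishes does not depend on the order `e` in which the columns are listed). -/
def representedBases {n : ℕ} (C : Matrix (Fin n) (Ground n) ℝ) : Set (AdmSet n n) :=
  {B | ∃ e : Fin n ≃ B.1, (C.submatrix id fun j => (e j : Ground n)).det ≠ 0}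

/-- `C` is a real orthogonal representation of `M`: its rows are a basis of an `n`-dimensional
totally isotropic (that is, Lagrangian) subspace of the orthogonal space `ℝ^J`, and `M` is the
collection of admissible sets of columns with non-zero minor. -/
structure IsOrthogonalRepresentation {n : ℕ} (C : Matrix (Fin n) (Ground n) ℝ)
    (M : Set (AdmSet n n)) : Prop where
  linearIndependent : LinearIndependent ℝ C.row
  isotropic : ∀ u ∈ Submodule.span ℝ (Set.range C.row),
    ∀ v ∈ Submodule.span ℝ (Set.range C.row), orthForm u v = 0
  bases_eq : M = representedBases C

/-! ### Pfaffians -/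

/-- The set `S'_{2m}` of permutations `σ` with `σ(2k-1) = min_{2k-1 ≤ j ≤ 2m} σ(j)` for
`1 ≤ k ≤ m` (indices are shifted by one: position `2k-1` is `2 * k` for `k : Fin m`). -/
def pfaffianPerms (m : ℕ) : Finset (Equiv.Perm (Fin (2 * m))) :=
  univ.filter fun σ => ∀ k : Fin m, ∀ j : Fin (2 * m), 2 * k.val ≤ j.val →
    σ ⟨2 * k.val, by omega⟩ ≤ σ j

/-- The Pfaffian of a `2m × 2m` (skew-symmetric) matrix. -/
def pfaffian {m : ℕ} (A : Matrix (Fin (2 * m)) (Fin (2 * m)) ℝ) : ℝ :=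
  ∑ σ ∈ pfaffianPerms m, ((Equiv.Perm.sign σ : ℤ) : ℝ) *
    ∏ k : Fin m, A (σ ⟨2 * k.val, by omega⟩) (σ ⟨2 * k.val + 1, by omega⟩)

/-- The Pfaffian of the principal minor of `A` indexed by `S`, with rows and columns in increasing
order; it is `0` if `S` has odd cardinality. -/
noncomputable def principalPfaffian {n : ℕ} (A : Matrix (Fin n) (Fin n) ℝ)
    (S : Finset (Fin n)) : ℝ :=
  if h : S.card = 2 * (S.card / 2) then
    pfaffian (A.submatrix (S.orderEmbOfFin h) (S.orderEmbOfFin h))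
  else 0

/-! ### The orientation procedure -/

/-- Swap the columns `j` and `j*` of `C` for all `j ∈ T`. -/
def swapColumns {n : ℕ} (C : Matrix (Fin n) (Ground n) ℝ) (T : Finset (Fin n)) :
    Matrix (Fin n) (Ground n) ℝ :=
  Matrix.of fun r x => if Sum.elim id id x ∈ T then C r (star x) else C r x

/-- The left-hand block `A'` after swapping the columns of `T = F ∩ I` and reducing the right-hand
block to the identity by row operations. -/
noncomputable def pivotMatrix {n : ℕ} (C : Matrix (Fin n) (Ground n) ℝ) (F : AdmSet n n) :
    Matrix (Fin n) (Fin n) ℝ :=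
  (swapColumns C (unstarred F.1)).toCols₂⁻¹ * (swapColumns C (unstarred F.1)).toCols₁

/-- The signs `ε_0 = 1`, `ε_i = ε_{i-1}` for `i ∉ T`, `ε_i = -ε_{i-1}` for `i ∈ T`; here
`i ∈ {1, …, n}`, and the label `i + 1` is the element `i` of `Fin n`. -/
def epsilon {n : ℕ} (T : Finset (Fin n)) : ℕ → ℝ
  | 0 => 1
  | i + 1 => if i ∈ T.image Fin.val then -epsilon T i else epsilon T i

/-- The matrix `A` with `a_{ij} = ε_i ε_j a'_{ij}`. -/
noncomputable def signedPivotMatrix {n : ℕ} (C : Matrix (Fin n) (Ground n) ℝ) (F : AdmSet n n) :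
    Matrix (Fin n) (Fin n) ℝ :=
  Matrix.of fun i j => epsilon (unstarred F.1) (i.val + 1) * epsilon (unstarred F.1) (j.val + 1) *
    pivotMatrix C F i j

/-- The sign assigned to `B`: that of the Pfaffian of the principal minor of `A` indexed by
`(B Δ F) ∩ I`. -/
noncomputable def orientation {n : ℕ} (C : Matrix (Fin n) (Ground n) ℝ) (F : AdmSet n n)
    (B : AdmSet n n) : SignType :=
  SignType.sign (principalPfaffian (signedPivotMatrix C F) (unstarred (symmDiff B.1 F.1)))

end OrthMat

/-!
The sign map of an orthogonal representation is read off from the pure spinor of the row space.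

For a basis `F` with unstarred part `T`, put `φ_F(S) = Pf(A_{S Δ T})`, a function on the subsets of
`I` (`spinor`). Expanding a Pfaffian along an arbitrary row
(`sum_sgnBelow_mul_principalPfaffian_erase`) says exactly that the Clifford action of every vector
of the row space of `C` annihilates `φ_F` (`clifford_spinor`); the signs `ε_i` are those that make
the Clifford signs independent of `F`. Conversely, a function annihilated by the row space is
determined by its value at `T` (`eq_zero_of_clifford_reducedRows`), so the functions `φ_F` for
different `F` are non-zero multiples of each other (`spinor_eq_mul`), which is the independence of
`F`. As `φ_F` takes the value `1` at `F`, proportionality also makes it non-zero at every basis. At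
an admissible set `B` that is not a basis some non-zero vector of the row space vanishes on `B`,
and its Clifford action forces `φ_F(B) = 0` (`spinor_ne_zero_iff`).

The same row expansion and skew-symmetry give the quadratic relations between principal Pfaffians
(`sum_principalPfaffian_symmDiff_mul`). The quantities `κ_j` are the signs of the summands of such
a relation, so if all are non-negative, all vanish; this is the oriented exchange axiom
(`isOrientedEvenDeltaMatroid_sign`). Applied to `A Δ {i}` and `B Δ {i}`, it yields simultaneous
symmetric exchange, from which a greedy argument and the parity of the bases give the Gale maxima
(`IsOrientedEvenDeltaMatroid.isOrthogonalMatroid`). That a basis exists at all follows from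
isotropy (`representedBases_nonempty`).
-/

namespace OrthMat

open Finset

/-! ### Expansion of the Pfaffian along its first row -/

/-- The permutation `0 ↦ 0`, `1 ↦ j + 1`, `i + 2 ↦ j.succAbove (τ i) + 1`. -/
def consPairPerm {m : ℕ} (j : Fin (m + 1)) (τ : Equiv.Perm (Fin m)) :
    Equiv.Perm (Fin (m + 2)) :=
  Equiv.Perm.decomposeFin.symm
    (0, j.cycleRange.symm * Equiv.Perm.decomposeFin.symm (0, τ))

theorem consPairPerm_zero {m : ℕ} (j : Fin (m + 1)) (τ : Equiv.Perm (Fin m)) :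
    consPairPerm j τ 0 = 0 := by
  simp [consPairPerm]

theorem consPairPerm_one {m : ℕ} (j : Fin (m + 1)) (τ : Equiv.Perm (Fin m)) :
    consPairPerm j τ 1 = j.succ := by
  have : (1 : Fin (m + 2)) = Fin.succ 0 := rfl
  rw [this, consPairPerm, Equiv.Perm.decomposeFin_symm_apply_succ]
  simp

theorem consPairPerm_succ_succ {m : ℕ} (j : Fin (m + 1)) (τ : Equiv.Perm (Fin m)) (i : Fin m) :
    consPairPerm j τ i.succ.succ = (j.succAbove (τ i)).succ := by
  rw [consPairPerm, Equiv.Perm.decomposeFin_symm_apply_succ]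
  simp

theorem sign_consPairPerm {m : ℕ} (j : Fin (m + 1)) (τ : Equiv.Perm (Fin m)) :
    Equiv.Perm.sign (consPairPerm j τ) = (-1) ^ (j : ℕ) * Equiv.Perm.sign τ := by
  simp [consPairPerm]

theorem exists_consPairPerm {m : ℕ} (σ : Equiv.Perm (Fin (m + 2))) (h : σ 0 = 0) :
    ∃ j τ, consPairPerm j τ = σ := by
  have key : ∀ {k : ℕ} (ρ : Equiv.Perm (Fin (k + 1))), ρ 0 = 0 →
      ∃ τ, Equiv.Perm.decomposeFin.symm (0, τ) = ρ := by
    intro k ρ hρ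
    obtain ⟨⟨q, τ⟩, rfl⟩ := Equiv.Perm.decomposeFin.symm.surjective ρ
    simp at hρ
    subst hρ
    exact ⟨τ, rfl⟩
  obtain ⟨ρ, rfl⟩ := key σ h
  obtain ⟨τ, hτ⟩ := key ((ρ 0).cycleRange * ρ) (by simp)
  exact ⟨ρ 0, τ, by rw [consPairPerm, hτ, ← mul_assoc]; simp [← Equiv.Perm.inv_def]⟩

theorem consPairPerm_injective {m : ℕ} {j j' : Fin (m + 1)} {τ τ' : Equiv.Perm (Fin m)}
    (h : consPairPerm j τ = consPairPerm j' τ') : j = j' ∧ τ = τ' := by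
  have h1 : j = j' := by
    have := congrArg (fun σ => σ 1) h
    simpa [consPairPerm_one] using this
  subst h1
  refine ⟨rfl, Equiv.ext fun i => ?_⟩
  have := congrArg (fun σ => σ i.succ.succ) h
  simpa [consPairPerm_succ_succ] using this

theorem consPairPerm_mem_pfaffianPerms {m : ℕ} (j : Fin (2 * m + 1))
    (τ : Equiv.Perm (Fin (2 * m))) :
    consPairPerm j τ ∈ pfaffianPerms (m + 1) ↔ τ ∈ pfaffianPerms m := by
  simp only [pfaffianPerms, mem_filter, mem_univ, true_and]
  constructor
  · intro h k i hi
    have := h k.succ i.succ.succ (by simp; omega)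
    have e : (⟨2 * (k.succ : ℕ), by have := k.2; simp; omega⟩ : Fin (2 * m + 2)) =
        (⟨2 * k.val, by omega⟩ : Fin (2 * m)).succ.succ := by
      ext; simp; omega
    erw [e, consPairPerm_succ_succ, consPairPerm_succ_succ] at this
    simpa using this
  · intro h k i hi
    induction k using Fin.cases with
    | zero =>
      have : consPairPerm j τ 0 ≤ consPairPerm j τ i := by
        rw [consPairPerm_zero]; exact Fin.zero_le _
      exact this
    | succ k =>
      obtain ⟨i, rfl⟩ : ∃ i' : Fin (2 * m), i = i'.succ.succ := by
        simp at hi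
        refine ⟨⟨i.val - 2, ?_⟩, ?_⟩
        · have := i.2; omega
        · ext; simp; omega
      have := h k i (by simp at hi; omega)
      have e : (⟨2 * (k.succ : ℕ), by have := k.2; simp; omega⟩ : Fin (2 * m + 2)) =
          (⟨2 * k.val, by omega⟩ : Fin (2 * m)).succ.succ := by
        ext; simp; omega
      erw [e, consPairPerm_succ_succ, consPairPerm_succ_succ]
      simpa using this

theorem pfaffian_zero (A : Matrix (Fin (2 * 0)) (Fin (2 * 0)) ℝ) : pfaffian A = 1 := by
  have : pfaffianPerms 0 = {1} := by
    ext σ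
    simp only [pfaffianPerms, mem_filter, mem_univ, true_and, mem_singleton]
    exact ⟨fun _ => Equiv.ext fun i => i.elim0, fun _ k => k.elim0⟩
  simp [pfaffian, this]

/-- Expansion of the Pfaffian along its first row. -/
theorem pfaffian_succ {m : ℕ} (A : Matrix (Fin (2 * m + 2)) (Fin (2 * m + 2)) ℝ) :
    pfaffian (m := m + 1) A = ∑ j : Fin (2 * m + 1), (-1) ^ (j : ℕ) * A 0 j.succ *
      pfaffian (A.submatrix (fun i => (j.succAbove i).succ) (fun i => (j.succAbove i).succ)) := by
  simp only [pfaffian, mul_sum, ← sum_product']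
  symm
  refine sum_bij (fun q _ => consPairPerm q.1 q.2) ?_ ?_ ?_ ?_
  · rintro ⟨j, τ⟩ h
    exact (consPairPerm_mem_pfaffianPerms j τ).2 (by simpa using h)
  · rintro ⟨j, τ⟩ - ⟨j', τ'⟩ - h
    obtain ⟨rfl, rfl⟩ := consPairPerm_injective h
    rfl
  · intro σ hσ
    have h0 : σ (0 : Fin (2 * m + 2)) = (0 : Fin (2 * m + 2)) := by
      have h := (mem_filter.1 hσ).2 0 (σ.symm (0 : Fin (2 * m + 2))) (by simp)
      rw [Equiv.apply_symm_apply] at h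
      exact le_antisymm h (Fin.zero_le _)
    obtain ⟨j, τ, rfl⟩ := exists_consPairPerm σ h0
    exact ⟨(j, τ), by simpa using (consPairPerm_mem_pfaffianPerms j τ).1 hσ, rfl⟩
  · rintro ⟨j, τ⟩ -
    have e : ∀ (k : Fin m) (c : ℕ) (hc : 2 * k.val + c < 2 * m)
        (hc' : 2 * (k.succ : ℕ) + c < 2 * m + 2),
        (⟨2 * (k.succ : ℕ) + c, hc'⟩ : Fin (2 * m + 2)) =
        (⟨2 * k.val + c, hc⟩ : Fin (2 * m)).succ.succ := by
      intro k c hc hc'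
      ext; simp; omega
    have h0 := consPairPerm_zero j τ
    have h1 := consPairPerm_one j τ
    have hs : Equiv.Perm.sign (consPairPerm j τ : Equiv.Perm (Fin (2 * (m + 1)))) =
      (-1) ^ (j : ℕ) * Equiv.Perm.sign τ := sign_consPairPerm j τ
    rw [hs, Fin.prod_univ_succ]
    have h2 : ∀ k : Fin m,
        A (consPairPerm j τ ⟨2 * (k.succ : ℕ), by have := k.2; simp; omega⟩)
          (consPairPerm j τ ⟨2 * (k.succ : ℕ) + 1, by simp⟩) =
        A (j.succAbove (τ ⟨2 * k.val, by omega⟩)).succ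
          (j.succAbove (τ ⟨2 * k.val + 1, by omega⟩)).succ := by
      intro k
      rw [← consPairPerm_succ_succ, ← consPairPerm_succ_succ, ← e k 1 (by omega) (by simp)]
      congr 2
    have h3 : A (consPairPerm j τ ⟨2 * ((0 : Fin (m + 1)) : ℕ), by simp⟩)
        (consPairPerm j τ ⟨2 * ((0 : Fin (m + 1)) : ℕ) + 1, by simp⟩) = A 0 j.succ := by
      rw [← h1]
      conv_rhs => rw [← h0]
      rfl
    have h4 := prod_congr (rfl : (univ : Finset (Fin m)) = univ) fun k _ => h2 k
    simp only [Matrix.submatrix_apply]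
    rw [← h4, ← h3]
    push_cast
    ring

theorem orderEmbOfFin_eq_of_strictMono {n k : ℕ} {f : Fin k → Fin n} (hf : StrictMono f)
    (h : (univ.image f).card = k) : ⇑((univ.image f).orderEmbOfFin h) = f :=
  ((univ.image f).orderEmbOfFin_unique h (fun x => mem_image_of_mem _ (mem_univ x)) hf).symm

theorem principalPfaffian_image {n m : ℕ} (A : Matrix (Fin n) (Fin n) ℝ)
    {f : Fin (2 * m) → Fin n} (hf : StrictMono f) :
    principalPfaffian A (univ.image f) = pfaffian (A.submatrix f f) := by
  have hc : (univ.image f).card = 2 * m := by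
    rw [card_image_of_injective _ hf.injective, card_fin]
  have gen : ∀ q (hq : (univ.image f).card = 2 * q), q = m →
      pfaffian (A.submatrix ((univ.image f).orderEmbOfFin hq)
        ((univ.image f).orderEmbOfFin hq)) = pfaffian (A.submatrix f f) := by
    rintro q hq rfl
    rw [orderEmbOfFin_eq_of_strictMono hf]
  have hm : (univ.image f).card / 2 = m := by omega
  rw [principalPfaffian, dif_pos (by omega)]
  exact gen _ _ hm

theorem principalPfaffian_empty {n : ℕ} (A : Matrix (Fin n) (Fin n) ℝ) :
    principalPfaffian A ∅ = 1 := by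
  have : (∅ : Finset (Fin n)) = univ.image (fun i : Fin (2 * 0) => i.elim0) := by simp
  rw [this, principalPfaffian_image A (fun i => i.elim0), pfaffian_zero]

theorem principalPfaffian_of_odd {n : ℕ} (A : Matrix (Fin n) (Fin n) ℝ) {S : Finset (Fin n)}
    (h : Odd S.card) : principalPfaffian A S = 0 := by
  obtain ⟨k, hk⟩ := h
  rw [principalPfaffian, dif_neg (by omega)]

/-! ### Signs -/

/-- The sign `(-1)^{#{x ∈ S : x < i}}`. -/
def sgnBelow {n : ℕ} (S : Finset (Fin n)) (i : Fin n) : ℝ := (-1) ^ (S.filter (· < i)).card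

theorem sgnBelow_eq_prod {n : ℕ} (S : Finset (Fin n)) (i : Fin n) :
    sgnBelow S i = ∏ x ∈ univ.filter (· < i), if x ∈ S then (-1 : ℝ) else 1 := by
  rw [prod_ite, prod_const_one, mul_one, prod_const, sgnBelow, filter_filter]
  congr 2
  ext x
  simp [and_comm]

theorem sgnBelow_symmDiff {n : ℕ} (S T : Finset (Fin n)) (i : Fin n) :
    sgnBelow (symmDiff S T) i = sgnBelow S i * sgnBelow T i := by
  simp only [sgnBelow_eq_prod, ← prod_mul_distrib]
  refine prod_congr rfl fun x _ => ?_
  by_cases h : x ∈ S <;> by_cases h' : x ∈ T <;> simp [mem_symmDiff, h, h']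

theorem sgnBelow_singleton {n : ℕ} (j i : Fin n) :
    sgnBelow {j} i = if j < i then -1 else 1 := by
  by_cases h : j < i <;> simp [sgnBelow, filter_singleton, h]

theorem sgnBelow_mul_self {n : ℕ} (S : Finset (Fin n)) (i : Fin n) :
    sgnBelow S i * sgnBelow S i = 1 := by
  rw [← sgnBelow_symmDiff]
  simp [sgnBelow]

theorem erase_eq_symmDiff {n : ℕ} {S : Finset (Fin n)} {i : Fin n} (h : i ∈ S) :
    S.erase i = symmDiff S {i} := by
  ext x
  simp only [mem_erase, mem_symmDiff, mem_singleton]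
  by_cases hx : x = i
  · simp [hx, h]
  · simp [hx]

theorem insert_eq_symmDiff {n : ℕ} {S : Finset (Fin n)} {i : Fin n} (h : i ∉ S) :
    insert i S = symmDiff S {i} := by
  ext x
  simp only [mem_insert, mem_symmDiff, mem_singleton]
  by_cases hx : x = i
  · simp [hx, h]
  · simp [hx]

theorem sgnBelow_erase {n : ℕ} {S : Finset (Fin n)} {j : Fin n} (h : j ∈ S) (i : Fin n) :
    sgnBelow (S.erase j) i = sgnBelow S i * if j < i then -1 else 1 := by
  rw [erase_eq_symmDiff h, sgnBelow_symmDiff, sgnBelow_singleton]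

theorem sgnBelow_insert {n : ℕ} {S : Finset (Fin n)} {j : Fin n} (h : j ∉ S) (i : Fin n) :
    sgnBelow (insert j S) i = sgnBelow S i * if j < i then -1 else 1 := by
  rw [insert_eq_symmDiff h, sgnBelow_symmDiff, sgnBelow_singleton]

theorem sgnBelow_of_forall_le {n : ℕ} {S : Finset (Fin n)} {i : Fin n} (h : ∀ x ∈ S, i ≤ x) :
    sgnBelow S i = 1 := by
  rw [sgnBelow, filter_false_of_mem fun x hx => (h x hx).not_gt, card_empty, pow_zero]

theorem card_filter_lt_orderEmbOfFin {n k : ℕ} (S : Finset (Fin n)) (h : S.card = k)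
    (j : Fin k) : (S.filter (· < S.orderEmbOfFin h j)).card = j := by
  have : S.filter (· < S.orderEmbOfFin h j) = (univ.filter (· < j)).map
      (S.orderEmbOfFin h).toEmbedding := by
    ext x
    simp only [mem_filter, mem_map, mem_univ, true_and, RelEmbedding.coe_toEmbedding]
    constructor
    · rintro ⟨hx, hlt⟩
      have : x ∈ Set.range (S.orderEmbOfFin h) := by rw [range_orderEmbOfFin]; exact hx
      obtain ⟨i, rfl⟩ := this
      exact ⟨i, by simpa using hlt, rfl⟩
    · rintro ⟨i, hi, rfl⟩
      exact ⟨orderEmbOfFin_mem _ _ _, by simpa using hi⟩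
  rw [this, card_map, ← Fin.card_Iio j]
  congr 1
  ext; simp

theorem sgnBelow_orderEmbOfFin {n k : ℕ} (S : Finset (Fin n)) (h : S.card = k) (j : Fin k) :
    sgnBelow S (S.orderEmbOfFin h j) = (-1) ^ (j : ℕ) := by
  rw [sgnBelow, card_filter_lt_orderEmbOfFin]

/-- Expansion of a principal Pfaffian along the row of its smallest index. -/
theorem principalPfaffian_insert_min {n : ℕ} (A : Matrix (Fin n) (Fin n) ℝ) (k : Fin n)
    (Y : Finset (Fin n)) (hk : ∀ y ∈ Y, k < y) :
    principalPfaffian A (insert k Y) =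
      ∑ j ∈ Y, sgnBelow Y j * A k j * principalPfaffian A (Y.erase j) := by
  have hkY : k ∉ Y := fun h => (hk k h).false
  obtain ⟨m, hm | hm⟩ := Nat.even_or_odd' Y.card
  · rw [principalPfaffian_of_odd A ⟨m, by rw [card_insert_of_notMem hkY, hm]⟩]
    refine (sum_eq_zero fun j hj => ?_).symm
    have := card_pos.2 ⟨j, hj⟩
    rw [principalPfaffian_of_odd A ⟨m - 1, by rw [card_erase_of_mem hj]; omega⟩, mul_zero]
  · set f := Y.orderEmbOfFin hm with hf
    have hY : Y = univ.map f.toEmbedding := by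
      ext x
      have : x ∈ Set.range f ↔ x ∈ Y := by rw [hf, range_orderEmbOfFin]; rfl
      simpa using this.symm
    have hg : StrictMono (Fin.cons k f : Fin (2 * m + 2) → Fin n) := by
      rw [Fin.strictMono_iff_lt_succ]
      intro i
      induction i using Fin.cases with
      | zero => exact hk _ (orderEmbOfFin_mem _ _ _)
      | succ i => simp
    have h1 : insert k Y = univ.image (Fin.cons k f : Fin (2 * m + 2) → Fin n) := by
      ext x
      conv_lhs => rw [hY]
      simp [Fin.exists_fin_succ, eq_comm]
    rw [h1, principalPfaffian_image (m := m + 1) A hg, pfaffian_succ]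
    conv_rhs => rw [hY, sum_map]
    refine sum_congr rfl fun j _ => ?_
    have h2 : Y.erase (f j) = univ.image fun i => f (j.succAbove i) := by
      ext x
      conv_lhs => rw [hY]
      simp only [mem_erase, mem_map, mem_univ, true_and, mem_image, RelEmbedding.coe_toEmbedding]
      constructor
      · rintro ⟨hx, i, rfl⟩
        obtain ⟨i', rfl⟩ := Fin.exists_succAbove_eq fun h : i = j => hx (h ▸ rfl)
        exact ⟨i', rfl⟩
      · rintro ⟨i, rfl⟩
        exact ⟨by simp [Fin.succAbove_ne], _, rfl⟩
    have h3 : sgnBelow Y (f j) = (-1) ^ (j : ℕ) := sgnBelow_orderEmbOfFin Y hm j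
    have h4 := principalPfaffian_image A (f.strictMono.comp (Fin.strictMono_succAbove j))
    rw [← hY, RelEmbedding.coe_toEmbedding, h3, h2]
    refine Eq.trans ?_ (congrArg _ h4.symm)
    rfl

/-! ### Relations between principal Pfaffians -/

/-- Interchanging two expansion steps changes the sign. -/
theorem sgnBelow_erase_swap {n : ℕ} {Y : Finset (Fin n)} {j l : Fin n} (hj : j ∈ Y) (hl : l ∈ Y)
    (h : j ≠ l) :
    sgnBelow Y j * sgnBelow (Y.erase j) l = -(sgnBelow Y l * sgnBelow (Y.erase l) j) := by
  rw [sgnBelow_erase hj, sgnBelow_erase hl]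
  rcases lt_or_gt_of_ne h with h' | h'
  · simp [h', h'.not_gt]; ring
  · simp [h', h'.not_gt]; ring

/-- Expansion of principal Pfaffians of a skew-symmetric matrix along an arbitrary row: the
left-hand side vanishes for `k ∈ Y`, as for a matrix with a repeated row. -/
theorem sum_sgnBelow_mul_principalPfaffian_erase {n : ℕ} {A : Matrix (Fin n) (Fin n) ℝ}
    (hA : A.transpose = -A) (k : Fin n) (Y : Finset (Fin n)) :
    ∑ j ∈ Y, sgnBelow Y j * A k j * principalPfaffian A (Y.erase j) =
      if k ∈ Y then 0 else sgnBelow Y k * principalPfaffian A (insert k Y) := by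
  have hskew : ∀ i j, A i j = -A j i := fun i j => congrFun (congrFun hA j) i
  have hdiag : ∀ i, A i i = 0 := fun i => by linarith [hskew i i]
  induction hc : Y.card using Nat.strong_induction_on generalizing k Y with
  | _ c ih =>
  by_cases hmin : ∀ y ∈ Y, k < y
  · rw [if_neg fun h => (hmin k h).false, principalPfaffian_insert_min A k Y hmin,
      sgnBelow_of_forall_le fun x hx => (hmin x hx).le, one_mul]
  have hne : Y.Nonempty := by
    rw [nonempty_iff_ne_empty]
    rintro rfl
    simp at hmin
  -- Split off the least element `m` of `Y`.
  obtain ⟨m, Z, hmZ, hZ, rfl⟩ : ∃ m Z, m ∉ Z ∧ (∀ z ∈ Z, m < z) ∧ insert m Z = Y :=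
    ⟨Y.min' hne, Y.erase (Y.min' hne), notMem_erase _ _,
      fun z hz => min'_lt_of_mem_erase_min' _ _ hz, insert_erase (min'_mem _ _)⟩
  have hmk : m ≤ k := by
    by_contra! hkm
    refine hmin fun y hy => ?_
    rcases mem_insert.1 hy with rfl | hy
    · exact hkm
    · exact hkm.trans (hZ y hy)
  rw [card_insert_of_notMem hmZ] at hc
  set φ := principalPfaffian A with hφ
  have expand : ∀ W : Finset (Fin n), (∀ w ∈ W, m < w) →
      φ (insert m W) = ∑ l ∈ W, sgnBelow W l * A m l * φ (W.erase l) :=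
    fun W hW => principalPfaffian_insert_min A m W hW
  -- The double expansion along the rows `m` and `k` is skew in the two rows.
  have hD : ∑ j ∈ Z, sgnBelow Z j * A k j * φ (insert m (Z.erase j)) =
      -∑ l ∈ Z, sgnBelow Z l * A m l *
        ∑ j ∈ Z.erase l, sgnBelow (Z.erase l) j * A k j * φ ((Z.erase l).erase j) := by
    rw [sum_congr rfl fun j _ => by
      rw [expand (Z.erase j) fun w hw => hZ w (mem_of_mem_erase hw)]]
    simp only [mul_sum]
    rw [sum_comm' (s' := fun l => Z.erase l) (t' := Z)
      (fun x y => by simp only [mem_erase]; tauto), ← sum_neg_distrib]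
    refine sum_congr rfl fun l hl => ?_
    rw [← sum_neg_distrib]
    refine sum_congr rfl fun j hj => ?_
    have := sgnBelow_erase_swap (mem_of_mem_erase hj) hl (ne_of_mem_erase hj)
    rw [erase_right_comm (a := j)]
    linear_combination A k j * A m l * φ ((Z.erase l).erase j) * this
  have hsplit : ∑ j ∈ insert m Z, sgnBelow (insert m Z) j * A k j * φ ((insert m Z).erase j) =
      A k m * φ Z - ∑ j ∈ Z, sgnBelow Z j * A k j * φ (insert m (Z.erase j)) := by
    rw [sum_insert hmZ, erase_insert hmZ, sgnBelow_of_forall_le (S := insert m Z) (i := m), one_mul,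
      sub_eq_add_neg, ← sum_neg_distrib]
    · congr 1
      refine sum_congr rfl fun j hj => ?_
      rw [sgnBelow_insert hmZ, if_pos (hZ j hj), erase_insert_of_ne (hZ j hj).ne]
      ring
    · intro x hx
      rcases mem_insert.1 hx with rfl | hx
      exacts [le_rfl, (hZ x hx).le]
  have hih : ∀ l ∈ Z, ∑ j ∈ Z.erase l, sgnBelow (Z.erase l) j * A k j * φ ((Z.erase l).erase j) =
      if k ∈ Z.erase l then 0 else sgnBelow (Z.erase l) k * φ (insert k (Z.erase l)) := by
    intro l hl
    refine ih (Z.erase l).card ?_ k (Z.erase l) rfl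
    have := card_erase_of_mem hl
    omega
  rw [hsplit, hD, sub_neg_eq_add]
  rcases hmk.eq_or_lt with rfl | hmk
  · rw [hdiag, if_pos (mem_insert_self _ _)]
    have h1 := hD
    rw [sum_congr rfl fun j _ => by
      rw [expand (Z.erase j) fun w hw => hZ w (mem_of_mem_erase hw)]] at h1
    linarith
  rw [sum_congr rfl fun l hl => by rw [hih l hl]]
  by_cases hkZ : k ∈ Z
  · rw [if_pos (mem_insert_of_mem hkZ), sum_eq_single_of_mem k hkZ]
    · rw [if_neg (notMem_erase _ _), insert_erase hkZ, sgnBelow_erase hkZ, if_neg (lt_irrefl _),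
        mul_one, hskew k m]
      linear_combination A m k * φ Z * sgnBelow_mul_self Z k
    · intro l _ hlk
      rw [if_pos (mem_erase.2 ⟨hlk.symm, hkZ⟩), mul_zero]
  · rw [if_neg (by simp [hkZ, hmk.ne']), Finset.insert_comm, expand (insert k Z)
      (by simpa [hmk] using hZ), sum_insert hkZ, erase_insert hkZ, sgnBelow_insert hmZ,
      if_pos hmk, sgnBelow_insert hkZ, if_neg (lt_irrefl _), mul_add, mul_sum, hskew k m]
    congr 1
    · linear_combination A m k * φ Z * sgnBelow_mul_self Z k
    · refine sum_congr rfl fun l hl => ?_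
      have hlk : l ≠ k := fun h => hkZ (h ▸ hl)
      rw [if_neg fun h => hkZ (mem_of_mem_erase h), erase_insert_of_ne hlk.symm, sgnBelow_erase hl,
        sgnBelow_insert hkZ]
      rcases lt_or_gt_of_ne hlk with h | h
      · simp [h, h.not_gt]; ring
      · simp [h, h.not_gt]; ring

/-- The quadratic relations between the principal Pfaffians of a skew-symmetric matrix. -/
theorem sum_principalPfaffian_symmDiff_mul {n : ℕ} {A : Matrix (Fin n) (Fin n) ℝ}
    (hA : A.transpose = -A) (Y Z : Finset (Fin n)) :
    ∑ k ∈ symmDiff Y Z, sgnBelow (symmDiff Y Z) k * principalPfaffian A (symmDiff Y {k}) *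
      principalPfaffian A (symmDiff Z {k}) = 0 := by
  have hskew : ∀ i j, A i j = -A j i := fun i j => congrFun (congrFun hA j) i
  set φ := principalPfaffian A with hφ
  have half : ∀ Y Z : Finset (Fin n),
      ∑ k ∈ Z \ Y, sgnBelow (symmDiff Y Z) k * φ (symmDiff Y {k}) * φ (symmDiff Z {k}) =
      ∑ k ∈ Z, ∑ j ∈ Y,
        A k j * (sgnBelow Z k * sgnBelow Y j * φ (Z.erase k) * φ (Y.erase j)) := by
    intro Y Z
    rw [sdiff_eq_filter, sum_filter]
    refine sum_congr rfl fun k hk => ?_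
    have h := sum_sgnBelow_mul_principalPfaffian_erase hA k Y
    rw [← hφ] at h
    have h2 : ∑ j ∈ Y, A k j * (sgnBelow Z k * sgnBelow Y j * φ (Z.erase k) * φ (Y.erase j)) =
        sgnBelow Z k * φ (Z.erase k) * ∑ j ∈ Y, sgnBelow Y j * A k j * φ (Y.erase j) := by
      rw [mul_sum]
      exact sum_congr rfl fun j _ => by ring
    rw [h2, h]
    by_cases hkY : k ∈ Y
    · simp [hkY]
    · rw [if_pos hkY, if_neg hkY, sgnBelow_symmDiff, insert_eq_symmDiff hkY, erase_eq_symmDiff hk]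
      ring
  have hs : symmDiff Y Z = (Z \ Y) ∪ (Y \ Z) := by
    rw [union_comm]; rfl
  have hd : Disjoint (Z \ Y) (Y \ Z) := disjoint_sdiff_sdiff
  have h2 := half Z Y
  rw [symmDiff_comm Z Y, sum_comm] at h2
  conv_lhs => rw [hs]
  rw [sum_union hd, ← hs, half Y Z, sum_congr rfl fun k _ => mul_right_comm _ _ _, h2,
    ← sum_add_distrib]
  refine sum_eq_zero fun k _ => ?_
  rw [← sum_add_distrib]
  refine sum_eq_zero fun j _ => ?_
  rw [hskew j k]
  ring

/-! ### Unstarred parts of admissible sets -/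

theorem unstarred_complete {n : ℕ} (A : Finset (Fin n)) : unstarred (complete A).1 = A :=
  (unstarred_eq_iff A _).2 rfl

theorem complete_unstarred {n : ℕ} (B : AdmSet n n) : complete (unstarred B.1) = B :=
  ((unstarred_eq_iff _ B).1 rfl).symm

theorem unstarred_symmDiff {n : ℕ} (A B : Finset (Ground n)) :
    unstarred (symmDiff A B) = symmDiff (unstarred A) (unstarred B) := by
  ext i
  simp [unstarred, mem_symmDiff]

theorem inl_mem_iff {n : ℕ} (B : Finset (Ground n)) (i : Fin n) :
    Sum.inl i ∈ B ↔ i ∈ unstarred B := by simp [unstarred]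

theorem inr_mem_iff {n : ℕ} (B : AdmSet n n) (i : Fin n) :
    Sum.inr i ∈ B.1 ↔ i ∉ unstarred B.1 := by
  conv_lhs => rw [← complete_unstarred B]
  simp [complete]

/-- The element of `{i, i*}` that lies in the admissible set with unstarred part `T`. -/
def transversal {n : ℕ} (T : Finset (Fin n)) (i : Fin n) : Ground n :=
  if i ∈ T then Sum.inl i else Sum.inr i

theorem mem_iff_eq_transversal {n : ℕ} (B : AdmSet n n) (x : Ground n) :
    x ∈ B.1 ↔ ∃ i, transversal (unstarred B.1) i = x := by
  constructor
  · rcases x with i | i <;> intro h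
    · exact ⟨i, if_pos ((inl_mem_iff _ _).1 h)⟩
    · exact ⟨i, if_neg ((inr_mem_iff _ _).1 h)⟩
  · rintro ⟨i, rfl⟩
    unfold transversal
    split_ifs with h
    exacts [(inl_mem_iff _ _).2 h, (inr_mem_iff _ _).2 h]

theorem transversal_injective {n : ℕ} (T : Finset (Fin n)) :
    Function.Injective (transversal T) := by
  intro i j h
  unfold transversal at h
  split_ifs at h <;> simpa using h

/-- Membership in `representedBases` may be tested on the columns in their natural order. -/
theorem mem_representedBases_iff {n : ℕ} (C : Matrix (Fin n) (Ground n) ℝ) (B : AdmSet n n) :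
    B ∈ representedBases C ↔ (C.submatrix id (transversal (unstarred B.1))).det ≠ 0 := by
  let e₀ : Fin n ≃ B.1 := Equiv.ofBijective
    (fun i => ⟨transversal (unstarred B.1) i, (mem_iff_eq_transversal B _).2 ⟨i, rfl⟩⟩)
    ⟨fun i j h => transversal_injective _ (congrArg Subtype.val h),
      fun x => by
        obtain ⟨i, hi⟩ := (mem_iff_eq_transversal B x.1).1 x.2
        exact ⟨i, Subtype.ext hi⟩⟩
  have key : ∀ e : Fin n ≃ B.1, (C.submatrix id fun j => (e j : Ground n)) =
      (C.submatrix id (transversal (unstarred B.1))).submatrix id (e.trans e₀.symm) := by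
    intro e
    ext i j
    have : transversal (unstarred B.1) (e₀.symm (e j)) = (e j : Ground n) :=
      congrArg Subtype.val (e₀.apply_symm_apply (e j))
    simp [this]
  constructor
  · rintro ⟨e, he⟩ h
    rw [key, Matrix.det_permute', h, mul_zero] at he
    exact he rfl
  · exact fun h => ⟨e₀, h⟩

theorem toCols₂_swapColumns {n : ℕ} (C : Matrix (Fin n) (Ground n) ℝ) (T : Finset (Fin n)) :
    (swapColumns C T).toCols₂ = C.submatrix id (transversal T) := by
  ext i j
  simp only [Matrix.toCols₂_apply, swapColumns, transversal, Matrix.of_apply,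
    Matrix.submatrix_apply, star, id]
  by_cases h : j ∈ T <;> simp [h]

/-! ### Isotropy -/

theorem orthForm_row_row {n : ℕ} {C : Matrix (Fin n) (Ground n) ℝ} {M : Set (AdmSet n n)}
    (hC : IsOrthogonalRepresentation C M) (i j : Fin n) : orthForm (C i) (C j) = 0 :=
  hC.isotropic _ (Submodule.subset_span ⟨i, rfl⟩) _ (Submodule.subset_span ⟨j, rfl⟩)

theorem orthForm_mul_row {n : ℕ} {C : Matrix (Fin n) (Ground n) ℝ} {M : Set (AdmSet n n)}
    (hC : IsOrthogonalRepresentation C M) (P : Matrix (Fin n) (Fin n) ℝ) (i j : Fin n) :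
    orthForm ((P * C) i) ((P * C) j) = 0 := by
  have : ∀ i, (P * C) i ∈ Submodule.span ℝ (Set.range C.row) := by
    intro i
    have : (P * C) i = ∑ k, P i k • C.row k := by
      ext x
      simp [Matrix.mul_apply, Matrix.row]
    rw [this]
    exact Submodule.sum_mem _ fun k _ => Submodule.smul_mem _ _ (Submodule.subset_span ⟨k, rfl⟩)
  exact hC.isotropic _ (this i) _ (this j)

theorem mul_swapColumns {n : ℕ} (P : Matrix (Fin n) (Fin n) ℝ) (C : Matrix (Fin n) (Ground n) ℝ)
    (T : Finset (Fin n)) : P * swapColumns C T = swapColumns (P * C) T := by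
  ext i x
  simp only [swapColumns, Matrix.mul_apply, Matrix.of_apply]
  split_ifs <;> rfl

theorem orthForm_swapColumns {n : ℕ} (C : Matrix (Fin n) (Ground n) ℝ) (T : Finset (Fin n))
    (i j : Fin n) : orthForm (swapColumns C T i) (swapColumns C T j) = orthForm (C i) (C j) := by
  simp only [orthForm, Fintype.sum_sum_type, ← sum_add_distrib]
  refine sum_congr rfl fun k _ => ?_
  by_cases h : k ∈ T <;> simp [swapColumns, star, h, add_comm]

theorem isUnit_columns {n : ℕ} {C : Matrix (Fin n) (Ground n) ℝ} {F : AdmSet n n}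
    (hF : F ∈ representedBases C) : IsUnit (swapColumns C (unstarred F.1)).toCols₂ := by
  rw [toCols₂_swapColumns, Matrix.isUnit_iff_isUnit_det, isUnit_iff_ne_zero]
  exact (mem_representedBases_iff C F).1 hF

theorem inv_mul_swapColumns {n : ℕ} {C : Matrix (Fin n) (Ground n) ℝ} {F : AdmSet n n}
    (hF : F ∈ representedBases C) :
    (swapColumns C (unstarred F.1)).toCols₂⁻¹ * swapColumns C (unstarred F.1) =
      Matrix.fromCols (pivotMatrix C F) 1 := by
  conv_lhs =>
    rw [← Matrix.fromCols_toCols (swapColumns C (unstarred F.1)), Matrix.mul_fromCols]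
  rw [Matrix.toCols₂_fromCols, Matrix.nonsing_inv_mul _
    ((Matrix.isUnit_iff_isUnit_det _).1 (isUnit_columns hF)), pivotMatrix]

theorem pivotMatrix_transpose {n : ℕ} {C : Matrix (Fin n) (Ground n) ℝ} {M : Set (AdmSet n n)}
    (hC : IsOrthogonalRepresentation C M) {F : AdmSet n n} (hF : F ∈ representedBases C) :
    (pivotMatrix C F).transpose = -pivotMatrix C F := by
  ext i j
  have h := orthForm_mul_row hC (swapColumns C (unstarred F.1)).toCols₂⁻¹ i j
  rw [← orthForm_swapColumns _ (unstarred F.1), ← mul_swapColumns, inv_mul_swapColumns hF] at h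
  simp [orthForm, star, Matrix.one_apply] at h
  simp only [Matrix.transpose_apply, Matrix.neg_apply]
  linarith

theorem signedPivotMatrix_transpose {n : ℕ} {C : Matrix (Fin n) (Ground n) ℝ}
    {M : Set (AdmSet n n)} (hC : IsOrthogonalRepresentation C M) {F : AdmSet n n}
    (hF : F ∈ representedBases C) :
    (signedPivotMatrix C F).transpose = -signedPivotMatrix C F := by
  ext i j
  have h := congrFun (congrFun (pivotMatrix_transpose hC hF) i) j
  simp only [Matrix.transpose_apply, Matrix.neg_apply] at h
  simp only [signedPivotMatrix, Matrix.transpose_apply, Matrix.neg_apply, Matrix.of_apply, h]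
  ring

/-! ### Spinors -/

/-- Clifford multiplication of the spinor `φ` by the vector `u`: `e_i` acts by adjoining `i` and
`e_{i*}` by minus the removal of `i`, each with the sign `(-1)^{#{x ∈ S : x < i}}`. -/
def clifford {n : ℕ} (u : Ground n → ℝ) (φ : Finset (Fin n) → ℝ) (S : Finset (Fin n)) : ℝ :=
  ∑ i, sgnBelow S i * (if i ∈ S then u (Sum.inl i) else -u (Sum.inr i)) * φ (symmDiff S {i})

theorem clifford_sum {n : ℕ} (c : Fin n → ℝ) (w : Fin n → Ground n → ℝ)
    (φ : Finset (Fin n) → ℝ) (S : Finset (Fin n)) :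
    clifford (fun x => ∑ k, c k * w k x) φ S = ∑ k, c k * clifford (w k) φ S := by
  simp only [clifford, mul_sum]
  rw [sum_comm]
  refine sum_congr rfl fun i _ => ?_
  split_ifs
  · rw [mul_sum, sum_mul]
    exact sum_congr rfl fun k _ => by ring
  · rw [← sum_neg_distrib, mul_sum, sum_mul]
    exact sum_congr rfl fun k _ => by ring

theorem clifford_sub_smul {n : ℕ} (u : Ground n → ℝ) (φ ψ : Finset (Fin n) → ℝ) (c : ℝ)
    (S : Finset (Fin n)) :
    clifford u (fun X => φ X - c * ψ X) S = clifford u φ S - c * clifford u ψ S := by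
  simp only [clifford, mul_sum, ← sum_sub_distrib]
  exact sum_congr rfl fun i _ => by ring

/-- The pure spinor of the row space of `C`, normalized to be `1` at the basis `F`. -/
noncomputable def spinor {n : ℕ} (C : Matrix (Fin n) (Ground n) ℝ) (F : AdmSet n n)
    (S : Finset (Fin n)) : ℝ :=
  principalPfaffian (signedPivotMatrix C F) (symmDiff S (unstarred F.1))

theorem orientation_eq {n : ℕ} (C : Matrix (Fin n) (Ground n) ℝ) (F B : AdmSet n n) :
    orientation C F B = SignType.sign (spinor C F (unstarred B.1)) := by
  rw [orientation, unstarred_symmDiff, spinor]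

theorem spinor_self {n : ℕ} (C : Matrix (Fin n) (Ground n) ℝ) (F : AdmSet n n) :
    spinor C F (unstarred F.1) = 1 := by
  rw [spinor, symmDiff_self, bot_eq_empty, principalPfaffian_empty]

theorem epsilon_eq_prod {n : ℕ} (T : Finset (Fin n)) (m : ℕ) :
    epsilon T m = ∏ i ∈ range m, if i ∈ T.image Fin.val then (-1 : ℝ) else 1 := by
  induction m with
  | zero => rfl
  | succ m ih =>
    rw [prod_range_succ, ← ih, epsilon]
    split_ifs <;> ring

theorem epsilon_eq_sgnBelow {n : ℕ} (T : Finset (Fin n)) (i : Fin n) :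
    epsilon T (i.val + 1) = sgnBelow T i * if i ∈ T then -1 else 1 := by
  have h : epsilon T i.val = sgnBelow T i := by
    rw [epsilon_eq_prod, sgnBelow, prod_ite, prod_const_one, mul_one, prod_const]
    congr 1
    rw [← card_map Fin.valEmbedding]
    congr 1
    ext x
    simp only [mem_filter, mem_range, mem_image, mem_map, Fin.valEmbedding_apply]
    constructor
    · rintro ⟨hx, t, ht, rfl⟩
      exact ⟨t, ⟨ht, hx⟩, rfl⟩
    · rintro ⟨t, ⟨ht, hx⟩, rfl⟩
      exact ⟨hx, t, ht, rfl⟩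
  rw [epsilon]
  have : i.val ∈ T.image Fin.val ↔ i ∈ T := by
    simp [Fin.val_inj]
  simp only [this, h]
  split_ifs <;> ring

/-- The reduced rows: the matrix row equivalent to `C` that has the identity in the columns of `F`,
with the columns in their original places. -/
noncomputable def reducedRows {n : ℕ} (C : Matrix (Fin n) (Ground n) ℝ) (F : AdmSet n n) :
    Matrix (Fin n) (Ground n) ℝ :=
  (swapColumns C (unstarred F.1)).toCols₂⁻¹ * C

theorem swapColumns_swapColumns {n : ℕ} (C : Matrix (Fin n) (Ground n) ℝ) (T : Finset (Fin n)) :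
    swapColumns (swapColumns C T) T = C := by
  ext i x
  rcases x with k | k <;> by_cases h : k ∈ T <;> simp [swapColumns, star, h]

theorem reducedRows_eq {n : ℕ} {C : Matrix (Fin n) (Ground n) ℝ} {F : AdmSet n n}
    (hF : F ∈ representedBases C) :
    reducedRows C F = swapColumns (Matrix.fromCols (pivotMatrix C F) 1) (unstarred F.1) := by
  rw [← inv_mul_swapColumns hF, mul_swapColumns, swapColumns_swapColumns, reducedRows]

theorem eq_mul_reducedRows {n : ℕ} {C : Matrix (Fin n) (Ground n) ℝ} {F : AdmSet n n}
    (hF : F ∈ representedBases C) :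
    C = (swapColumns C (unstarred F.1)).toCols₂ * reducedRows C F := by
  rw [reducedRows, ← Matrix.mul_assoc, Matrix.mul_nonsing_inv _
    ((Matrix.isUnit_iff_isUnit_det _).1 (isUnit_columns hF)), Matrix.one_mul]

/-- The spinor is annihilated by the reduced rows: this is the expansion of a principal Pfaffian
along an arbitrary row. The signs `ε_i` turn `#{x ∈ S Δ T : x < i}` into `#{x ∈ S : x < i}`. -/
theorem clifford_reducedRows_spinor {n : ℕ} {C : Matrix (Fin n) (Ground n) ℝ}
    {M : Set (AdmSet n n)} (hC : IsOrthogonalRepresentation C M) {F : AdmSet n n}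
    (hF : F ∈ representedBases C) (k : Fin n) (S : Finset (Fin n)) :
    clifford (reducedRows C F k) (spinor C F) S = 0 := by
  set T := unstarred F.1 with hT
  set Y := symmDiff S T with hY
  have hS : S = symmDiff Y T := by rw [hY, symmDiff_assoc, symmDiff_self, symmDiff_bot]
  have hR := sum_sgnBelow_mul_principalPfaffian_erase (signedPivotMatrix_transpose hC hF) k Y
  have hφ : ∀ i, spinor C F (symmDiff S {i}) =
      principalPfaffian (signedPivotMatrix C F) (symmDiff Y {i}) := by
    intro i
    rw [spinor, ← hT, hY, symmDiff_right_comm]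
  have hterm : ∀ i, sgnBelow S i * (if i ∈ S then reducedRows C F k (Sum.inl i) else
      -reducedRows C F k (Sum.inr i)) * spinor C F (symmDiff S {i}) =
      (epsilon T (k.val + 1) * if i ∈ Y then sgnBelow Y i * signedPivotMatrix C F k i *
        principalPfaffian (signedPivotMatrix C F) (Y.erase i) else 0) -
      (if i = k then epsilon T (k.val + 1) * (if k ∈ Y then 0 else sgnBelow Y k *
        principalPfaffian (signedPivotMatrix C F) (insert k Y)) else 0) := by
    intro i
    have hsq : epsilon T (k.val + 1) * epsilon T (k.val + 1) = 1 := by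
      rw [epsilon_eq_sgnBelow]
      split_ifs <;> linear_combination sgnBelow_mul_self T k
    have hsT' : epsilon T (i.val + 1) = _ := epsilon_eq_sgnBelow T i
    rw [hφ, reducedRows_eq hF, ← hT]
    have hSY : sgnBelow S i = sgnBelow Y i * sgnBelow T i := by rw [hS, sgnBelow_symmDiff]
    have hmem : i ∈ S ↔ ¬ (i ∈ Y ↔ i ∈ T) := by
      conv_lhs => rw [hS]
      rw [mem_symmDiff]; tauto
    by_cases hiY : i ∈ Y
    · have h0 : (if i = k then epsilon T (k.val + 1) * (if k ∈ Y then 0 else sgnBelow Y k *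
        principalPfaffian (signedPivotMatrix C F) (insert k Y)) else 0) = 0 := by
        split_ifs with h1 h2
        · rw [mul_zero]
        · exact absurd (h1 ▸ hiY) h2
        · rfl
      have hA : signedPivotMatrix C F k i =
          epsilon T (k.val + 1) * epsilon T (i.val + 1) * pivotMatrix C F k i := rfl
      rw [h0, if_pos hiY, erase_eq_symmDiff hiY, hA, hsT', hSY]
      by_cases hiT : i ∈ T
      · simp [hmem, hiY, hiT, swapColumns, star]
        linear_combination -pivotMatrix C F k i * principalPfaffian (signedPivotMatrix C F)
          (symmDiff Y {i}) * sgnBelow Y i * sgnBelow T i * hsq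
      · simp [hmem, hiY, hiT, swapColumns, star]
        linear_combination -pivotMatrix C F k i * principalPfaffian (signedPivotMatrix C F)
          (symmDiff Y {i}) * sgnBelow Y i * sgnBelow T i * hsq
    · rw [if_neg hiY, mul_zero, zero_sub]
      by_cases hik : i = k
      · subst hik
        rw [if_pos rfl, if_neg hiY, insert_eq_symmDiff hiY, hsT', hSY]
        by_cases hiT : i ∈ T
        · simp [hmem, hiY, hiT, swapColumns, star]
          try ring
        · simp [hmem, hiY, hiT, swapColumns, star]
          try ring
      · rw [if_neg hik]
        by_cases hiT : i ∈ T
        · simp [hmem, hiY, hiT, swapColumns, star, Ne.symm hik]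
        · simp [hmem, hiY, hiT, swapColumns, star, Ne.symm hik]
  rw [clifford, sum_congr rfl fun i _ => hterm i, sum_sub_distrib, ← mul_sum, ← sum_filter,
    filter_mem_eq_inter, univ_inter, hR, sum_ite_eq', if_pos (mem_univ k), sub_self]

theorem clifford_spinor {n : ℕ} {C : Matrix (Fin n) (Ground n) ℝ} {M : Set (AdmSet n n)}
    (hC : IsOrthogonalRepresentation C M) {F : AdmSet n n} (hF : F ∈ representedBases C)
    (c : Fin n → ℝ) (S : Finset (Fin n)) :
    clifford (Matrix.vecMul c C) (spinor C F) S = 0 := by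
  have : Matrix.vecMul c C = fun x => ∑ k, Matrix.vecMul c
      (swapColumns C (unstarred F.1)).toCols₂ k * reducedRows C F k x := by
    conv_lhs => rw [eq_mul_reducedRows hF, ← Matrix.vecMul_vecMul]
    rfl
  rw [this, clifford_sum _ (reducedRows C F)]
  exact sum_eq_zero fun k _ => by rw [clifford_reducedRows_spinor hC hF, mul_zero]

/-- A function annihilated by the reduced rows at `F` is determined by its value at `F`. -/
theorem eq_zero_of_clifford_reducedRows {n : ℕ} {C : Matrix (Fin n) (Ground n) ℝ} {F : AdmSet n n}
    (hF : F ∈ representedBases C) {φ : Finset (Fin n) → ℝ}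
    (hφ : ∀ k S, clifford (reducedRows C F k) φ S = 0) (h0 : φ (unstarred F.1) = 0)
    (S : Finset (Fin n)) : φ S = 0 := by
  set T := unstarred F.1 with hT
  induction hc : (symmDiff S T).card using Nat.strong_induction_on generalizing S with
  | _ c ih =>
  rcases (symmDiff S T).eq_empty_or_nonempty with h | ⟨k, hk⟩
  · rw [← bot_eq_empty, symmDiff_eq_bot] at h
    rw [h, h0]
  have h := hφ k (symmDiff S {k})
  rw [reducedRows_eq hF, ← hT, clifford, sum_eq_single k] at h
  · rw [symmDiff_assoc, symmDiff_self, symmDiff_bot] at h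
    have hs : sgnBelow (symmDiff S {k}) k ≠ 0 := pow_ne_zero _ (by norm_num)
    have hmem : k ∈ symmDiff S {k} ↔ k ∈ T := by
      rw [mem_symmDiff] at hk ⊢
      simp only [mem_singleton]
      tauto
    by_cases hkT : k ∈ T <;>
      simpa [hmem, hkT, swapColumns, star, hs] using h
  · intro i _ hik
    have hmem : i ∈ symmDiff S {k} ↔ i ∈ S := by simp [mem_symmDiff, hik]
    by_cases hi : i ∈ symmDiff S T
    · rw [ih (symmDiff (symmDiff (symmDiff S {k}) {i}) T).card ?_ _ rfl, mul_zero]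
      have : symmDiff (symmDiff (symmDiff S {k}) {i}) T =
          ((symmDiff S T).erase k).erase i := by
        rw [erase_eq_symmDiff hk, erase_eq_symmDiff (mem_symmDiff.2 (Or.inl ⟨hi, by simpa⟩)),
          symmDiff_right_comm _ _ T, symmDiff_right_comm _ _ T]
      rw [this, ← hc]
      exact (card_le_card (erase_subset _ _)).trans_lt (card_erase_lt_of_mem hk)
    · have : i ∈ S ↔ i ∈ T := by
        rw [mem_symmDiff] at hi; tauto
      by_cases hiT : i ∈ T <;>
        simp [hmem, this, hiT, swapColumns, star, Ne.symm hik]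
  · exact fun h => absurd (mem_univ k) h

/-- The spinors computed from two bases are proportional. -/
theorem spinor_eq_mul {n : ℕ} {C : Matrix (Fin n) (Ground n) ℝ} {M : Set (AdmSet n n)}
    (hC : IsOrthogonalRepresentation C M) {F F' : AdmSet n n} (hF : F ∈ representedBases C)
    (hF' : F' ∈ representedBases C) (S : Finset (Fin n)) :
    spinor C F' S = spinor C F' (unstarred F.1) * spinor C F S := by
  rw [← sub_eq_zero]
  refine eq_zero_of_clifford_reducedRows hF
    (φ := fun X => spinor C F' X - spinor C F' (unstarred F.1) * spinor C F X) ?_ ?_ S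
  · intro k S
    rw [clifford_sub_smul, clifford_reducedRows_spinor hC hF]
    have : reducedRows C F k =
        Matrix.vecMul ((swapColumns C (unstarred F.1)).toCols₂⁻¹ k) C := rfl
    rw [this, clifford_spinor hC hF']
    ring
  · rw [spinor_self]; ring

/-- The support of the spinor is the set of bases. If `B` is not a basis, some vector of the row
space vanishes on `B` but not at the star `x*` of some `x ∈ B`; its Clifford action, evaluated at
`B` with `x` exchanged for `x*`, has the single term `± u(x*) φ(B)`. -/
theorem spinor_ne_zero_iff {n : ℕ} {C : Matrix (Fin n) (Ground n) ℝ} {M : Set (AdmSet n n)}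
    (hC : IsOrthogonalRepresentation C M) {F : AdmSet n n} (hF : F ∈ representedBases C)
    (B : AdmSet n n) : spinor C F (unstarred B.1) ≠ 0 ↔ B ∈ representedBases C := by
  constructor
  · contrapose!
    intro hB
    rw [mem_representedBases_iff, not_not, ← Matrix.exists_vecMul_eq_zero_iff] at hB
    obtain ⟨c, hc, hcB⟩ := hB
    have hu0 : ∀ i, Matrix.vecMul c C (transversal (unstarred B.1) i) = 0 :=
      fun i => congrFun hcB i
    have hne : Matrix.vecMul c C ≠ 0 := by
      intro h
      refine hc (Matrix.vecMul_injective_iff.2 hC.linearIndependent ?_)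
      simpa using h
    obtain ⟨i, hi⟩ : ∃ i, Matrix.vecMul c C (star (transversal (unstarred B.1) i)) ≠ 0 := by
      by_contra! hcon
      refine hne (funext fun x => ?_)
      rcases x with i | i <;> have h1 := hu0 i <;> have h2 := hcon i <;>
        by_cases h : i ∈ unstarred B.1 <;> simp_all [transversal, star]
    have h := clifford_spinor hC hF c (symmDiff (unstarred B.1) {i})
    rw [clifford, sum_eq_single i] at h
    · rw [symmDiff_assoc, symmDiff_self, symmDiff_bot] at h
      have hs : sgnBelow (symmDiff (unstarred B.1) {i}) i ≠ 0 := pow_ne_zero _ (by norm_num)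
      by_cases hiB : i ∈ unstarred B.1 <;> simp [transversal, star, hiB] at hi <;>
        simpa [mem_symmDiff, hiB, hs, hi] using h
    · intro j _ hji
      have h1 := hu0 j
      by_cases hjB : j ∈ unstarred B.1 <;>
        simp_all [transversal, mem_symmDiff]
    · exact fun h => absurd (mem_univ i) h
  · intro hB h
    have := spinor_eq_mul hC hF hB (unstarred B.1)
    rw [spinor_self, h, mul_zero] at this
    exact one_ne_zero this

/-! ### Existence of a basis -/

theorem star_star {n : ℕ} (x : Ground n) : star (star x) = x := Sum.swap_swap x

theorem star_ne {n : ℕ} (x : Ground n) : star x ≠ x := by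
  rcases x with i | i <;> simp [star]

theorem admissible_iff {n : ℕ} {A : Finset (Ground n)} :
    Admissible A ↔ ∀ x ∈ A, star x ∉ A := by
  rw [Admissible, disjoint_left]
  refine forall₂_congr fun x _ => not_congr ?_
  rw [mem_image]
  exact ⟨fun ⟨y, hy, h⟩ => by rwa [← h, star_star], fun h => ⟨_, h, star_star x⟩⟩

/-- A maximal admissible independent set of columns is a basis. A functional `f` that vanishes on
it kills all columns outside `A*`, and isotropy, `∑ f(c_x) c_{x*} = 0`, is then a linear relation
between the columns of `A`. -/
theorem representedBases_nonempty {n : ℕ} {C : Matrix (Fin n) (Ground n) ℝ} {M : Set (AdmSet n n)}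
    (hC : IsOrthogonalRepresentation C M) : (representedBases C).Nonempty := by
  classical
  obtain ⟨A, hA, hmax⟩ := exists_max_image (univ.filter fun A : Finset (Ground n) =>
    Admissible A ∧ LinearIndepOn ℝ C.col A) card
    ⟨∅, by simp [admissible_iff]⟩
  simp only [mem_filter, mem_univ, true_and] at hA hmax
  obtain ⟨hadm, hind⟩ := hA
  have houtside : ∀ x, x ∉ A → star x ∉ A → C.col x ∈ Submodule.span ℝ (C.col '' A) := by
    intro x hx hx'
    by_contra hspan
    have h := hmax (insert x A) ⟨?_, ?_⟩
    · rw [card_insert_of_notMem hx] at h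
      omega
    · rw [admissible_iff] at hadm ⊢
      intro y hy hy'
      rcases mem_insert.1 hy with rfl | hy <;> rcases mem_insert.1 hy' with h | h
      · exact star_ne _ h
      · exact hx' h
      · exact hx' (by rw [← h, star_star]; exact hy)
      · exact hadm y hy h
    · rw [coe_insert]
      exact (linearIndepOn_insert (by simpa using hx)).2 ⟨hind, hspan⟩
  have htop : Submodule.span ℝ (C.col '' A) = ⊤ := by
    by_contra hne
    obtain ⟨f, hf0, hf⟩ := Submodule.exists_le_ker_of_lt_top _ (lt_top_iff_ne_top.2 hne)
    have hfA : ∀ x ∈ A, f (C.col x) = 0 := fun x hx => hf (Submodule.subset_span ⟨x, hx, rfl⟩)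
    have hfcol : ∀ x, f (C.col x) = ∑ r, C r x * f (Pi.single r 1) := by
      intro x
      conv_lhs => rw [pi_eq_sum_univ (C.col x)]
      rw [map_sum]
      refine sum_congr rfl fun r _ => ?_
      rw [map_smul, smul_eq_mul]
      congr 2
      ext j
      simp [Pi.single_apply, eq_comm]
    -- Isotropy of the rows, contracted with `f`.
    have hrel : ∑ x, f (C.col (star x)) • C.col x = 0 := by
      ext s
      simp only [Finset.sum_apply, Pi.smul_apply, smul_eq_mul, hfcol, Pi.zero_apply, sum_mul]
      rw [sum_comm]
      refine sum_eq_zero fun r _ => ?_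
      have h := orthForm_row_row hC s r
      calc ∑ x, C r (star x) * f (Pi.single r 1) * C.col x s
          = f (Pi.single r 1) * orthForm (C s) (C r) := by
            rw [orthForm, mul_sum]
            exact sum_congr rfl fun x _ => by simp only [Matrix.col_apply]; ring
        _ = 0 := by rw [h, mul_zero]
    have hzero : ∀ x, x ∉ A → f (C.col (star x)) = 0 := by
      intro x hx
      by_cases hx' : star x ∈ A
      · exact hfA _ hx'
      · exact hf (houtside _ hx' (by rwa [star_star]))
    have hrelA : ∑ x ∈ A, f (C.col (star x)) • C.col x = 0 := by
      rw [← hrel]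
      exact sum_subset (subset_univ _) fun x _ hx => by rw [hzero x hx, zero_smul]
    have hall : ∀ x, f (C.col (star x)) = 0 := by
      intro x
      by_cases hx : x ∈ A
      · exact linearIndepOn_finset_iff.1 hind _ hrelA x hx
      · exact hzero x hx
    have hv : (fun r => f (Pi.single r 1)) = 0 := by
      refine Matrix.vecMul_injective_iff.2 hC.linearIndependent ?_
      ext x
      have := hall (star x)
      rw [star_star, hfcol] at this
      simpa [Matrix.vecMul, dotProduct, mul_comm] using this
    refine hf0 (LinearMap.pi_ext' fun r => LinearMap.ext_ring ?_)
    simpa using congrFun hv r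
  have hcard : A.card = n := by
    have h := finrank_span_eq_card hind
    rw [← Set.image_eq_range, htop, finrank_top] at h
    simpa using h.symm
  refine ⟨⟨A, hcard, hadm⟩, (mem_representedBases_iff C _).2 ?_⟩
  rw [← isUnit_iff_ne_zero, ← Matrix.isUnit_iff_isUnit_det,
    ← Matrix.linearIndependent_cols_iff_isUnit]
  exact hind.comp
    (fun i => ⟨transversal _ i, (mem_iff_eq_transversal ⟨A, hcard, hadm⟩ _).2 ⟨i, rfl⟩⟩)
    fun i j h => transversal_injective _ (congrArg Subtype.val h)

/-! ### The oriented exchange axiom -/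

/-- The signs of a function with the quadratic relations of a spinor form an oriented even
`Δ`-matroid: `κ_j` is the sign of a term of a sum that vanishes. -/
theorem isOrientedEvenDeltaMatroid_sign {n : ℕ} {φ : Finset (Fin n) → ℝ}
    (hne : ∃ A, φ A ≠ 0)
    (heven : ∀ A B, φ A ≠ 0 → φ B ≠ 0 → A.card ≡ B.card [MOD 2])
    (hquad : ∀ A B, ∑ k ∈ symmDiff A B,
      sgnBelow (symmDiff A B) k * φ (symmDiff A {k}) * φ (symmDiff B {k}) = 0) :
    IsOrientedEvenDeltaMatroid fun S => SignType.sign (φ S) where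
  nonzero := by simpa [sign_eq_zero_iff] using hne
  even A B hA hB := heven A B (by simpa using hA) (by simpa using hB)
  exchange A B w hw hκ := by
    set D := symmDiff A B with hD
    -- The sign `(-1)^j` of `κ_j` counts from `1`, that of the quadratic relation from `0`.
    set W : ℝ := -(w : ℝ) with hW
    have hw' : SignType.sign (-W) = w := by
      rcases hw with rfl | rfl <;> simp [hW]
    set t : Fin D.card → ℝ := fun j => W * (sgnBelow D (D.orderEmbOfFin rfl j) *
      φ (symmDiff A {D.orderEmbOfFin rfl j}) * φ (symmDiff B {D.orderEmbOfFin rfl j})) with ht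
    have hsign : ∀ j, kappa (fun S => SignType.sign (φ S)) A B w j = SignType.sign (t j) := by
      intro j
      simp only [ht, sgnBelow_orderEmbOfFin, sign_mul, kappa, sign_pow, Left.sign_neg, sign_one,
        pow_succ, ← hD]
      rw [← hw', Left.sign_neg]
      rcases hw with rfl | rfl <;> simp [hW, mul_assoc]
    have hsum : ∑ j, t j = 0 := by
      rw [ht, ← mul_sum]
      have h := hquad A B
      rw [← hD] at h
      have hmap : univ.map (D.orderEmbOfFin rfl).toEmbedding = D := by
        ext x
        simp
      conv at h => lhs; rw [← hmap]
      rw [sum_map] at h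
      simp only [hmap] at h
      exact mul_eq_zero_of_right _ h
    have hnonneg : ∀ j, 0 ≤ t j := by
      intro j
      have := hκ j
      rw [hsign] at this
      exact sign_nonneg_iff.1 this
    intro j
    rw [hsign, (sum_eq_zero_iff_of_nonneg fun j _ => hnonneg j).1 hsum j (mem_univ j), sign_zero]

theorem card_symmDiff_add {α : Type*} [DecidableEq α] (S T : Finset α) :
    (symmDiff S T).card + 2 * (S ∩ T).card = S.card + T.card := by
  have h1 := card_sdiff_add_card_inter S T
  have h2 := card_sdiff_add_card_inter T S
  rw [inter_comm] at h2
  have h3 : (symmDiff S T).card = (S \ T).card + (T \ S).card :=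
    card_union_of_disjoint disjoint_sdiff_sdiff
  omega

theorem isOrientedEvenDeltaMatroid_orientation {n : ℕ} {C : Matrix (Fin n) (Ground n) ℝ}
    {M : Set (AdmSet n n)} (hC : IsOrthogonalRepresentation C M) {F : AdmSet n n}
    (hF : F ∈ representedBases C) :
    IsOrientedEvenDeltaMatroid (forgetStars (orientation C F)) := by
  have h : forgetStars (orientation C F) = fun S => SignType.sign (spinor C F S) := by
    ext S
    rw [forgetStars, orientation_eq, unstarred_complete]
  rw [h]
  refine isOrientedEvenDeltaMatroid_sign ⟨unstarred F.1, by simp [spinor_self]⟩ ?_ ?_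
  · have hpar : ∀ S, spinor C F S ≠ 0 → S.card ≡ (unstarred F.1).card [MOD 2] := by
      intro S hS
      by_contra hcon
      refine hS (principalPfaffian_of_odd _ ?_)
      have h1 := card_symmDiff_add S (unstarred F.1)
      rw [Nat.odd_iff]
      rw [Nat.ModEq] at hcon
      omega
    exact fun A B hA hB => (hpar A hA).trans (hpar B hB).symm
  · intro A B
    have h := sum_principalPfaffian_symmDiff_mul (signedPivotMatrix_transpose hC hF)
      (symmDiff A (unstarred F.1)) (symmDiff B (unstarred F.1))
    rw [symmDiff_symmDiff_symmDiff_comm, symmDiff_self, symmDiff_bot] at h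
    simpa only [spinor, symmDiff_right_comm _ {_}] using h

/-! ### Gale maxima -/

/-- The number of elements of `S` below `t`. -/
def countBelow {N : ℕ} (S : Finset (Fin N)) (t : ℕ) : ℕ := (S.filter fun s => s.val < t).card

theorem countBelow_succ {N : ℕ} (S : Finset (Fin N)) {t : ℕ} (ht : t < N) :
    countBelow S (t + 1) = countBelow S t + if ⟨t, ht⟩ ∈ S then 1 else 0 := by
  unfold countBelow
  split_ifs with h
  · rw [← card_insert_of_notMem (a := (⟨t, ht⟩ : Fin N)) (by simp)]
    congr 1
    ext s
    simp only [mem_filter, mem_insert, Fin.ext_iff]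
    constructor
    · rintro ⟨h1, h2⟩
      by_cases h3 : s.val = t
      · exact Or.inl h3
      · exact Or.inr ⟨h1, by omega⟩
    · rintro (h1 | ⟨h1, h2⟩)
      · obtain rfl : s = ⟨t, ht⟩ := Fin.ext h1
        exact ⟨h, by simp⟩
      · exact ⟨h1, by omega⟩
  · rw [add_zero]
    congr 1
    ext s
    simp only [mem_filter, and_congr_right_iff]
    intro hs
    have : s.val ≠ t := by
      rintro rfl
      exact h hs
    omega

theorem countBelow_zero {N : ℕ} (S : Finset (Fin N)) : countBelow S 0 = 0 := by
  simp [countBelow]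

theorem countBelow_of_le {N : ℕ} (S : Finset (Fin N)) {t : ℕ} (ht : N ≤ t) :
    countBelow S t = S.card := by
  rw [countBelow, filter_true_of_mem fun s _ => s.2.trans_le ht]

theorem countBelow_mono {N : ℕ} (S : Finset (Fin N)) {s t : ℕ} (h : s ≤ t) :
    countBelow S s ≤ countBelow S t :=
  card_le_card fun x hx => by
    rw [mem_filter] at hx ⊢
    exact ⟨hx.1, by omega⟩

theorem countBelow_orderEmbOfFin {N k : ℕ} (S : Finset (Fin N)) (h : S.card = k) (i : Fin k) :
    countBelow S (S.orderEmbOfFin h i).val = i :=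
  card_filter_lt_orderEmbOfFin S h i

theorem orderEmbOfFin_le_of_countBelow_le {N k : ℕ} {S S' : Finset (Fin N)} (h : S.card = k)
    (h' : S'.card = k) (hle : ∀ t ≤ N, countBelow S' t ≤ countBelow S t) (i : Fin k) :
    S.orderEmbOfFin h i ≤ S'.orderEmbOfFin h' i := by
  by_contra! hlt
  set s := S.orderEmbOfFin h i with hs
  set s' := S'.orderEmbOfFin h' i with hs'
  have h1 := countBelow_orderEmbOfFin S h i
  have h2 := countBelow_orderEmbOfFin S' h' i
  rw [← hs] at h1
  rw [← hs'] at h2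
  have h3 := countBelow_succ S' s'.2
  rw [Fin.eta, if_pos (orderEmbOfFin_mem _ _ _)] at h3
  have h4 := countBelow_mono S' (Nat.succ_le_of_lt (Fin.lt_def.1 hlt))
  have h5 := hle s.val s.2.le
  simp only [Nat.succ_eq_add_one] at h4
  omega

theorem mem_symmDiff_pair {n : ℕ} (X : Finset (Fin n)) {i j x : Fin n} (hij : j ≠ i) :
    x ∈ symmDiff (symmDiff X {i}) {j} ↔ if x = i ∨ x = j then x ∉ X else x ∈ X := by
  by_cases h1 : x = i
  · subst h1; simp [mem_symmDiff, hij.symm]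
  · by_cases h2 : x = j
    · subst h2; simp [mem_symmDiff, h1]
    · simp [mem_symmDiff, h1, h2]

/-- A family of sets with simultaneous symmetric exchange has a member whose initial segments
are all of maximal size. The member is found by maximizing `∑ i ∈ X, (n - i)`. -/
theorem exists_countBelow_le {n : ℕ} {𝓕 : Finset (Fin n) → Prop} (hne : ∃ X, 𝓕 X)
    (hex : ∀ X Y, 𝓕 X → 𝓕 Y → ∀ i ∈ symmDiff X Y, ∃ j ∈ symmDiff X Y, j ≠ i ∧
      𝓕 (symmDiff (symmDiff X {i}) {j}) ∧ 𝓕 (symmDiff (symmDiff Y {i}) {j})) :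
    ∃ B, 𝓕 B ∧ ∀ X, 𝓕 X → ∀ t ≤ n, countBelow X t ≤ countBelow B t := by
  classical
  obtain ⟨X₀, hX₀⟩ := hne
  obtain ⟨B, hB, hmax⟩ := exists_max_image (univ.filter fun X => 𝓕 X)
    (fun X => ∑ i ∈ X, ((n : ℤ) - i.val)) ⟨X₀, by simpa using hX₀⟩
  simp only [mem_filter, mem_univ, true_and] at hB hmax
  refine ⟨B, hB, fun X hX => ?_⟩
  induction hc : (symmDiff X B).card using Nat.strong_induction_on generalizing X with
  | _ c ih =>
  by_contra! hcon
  -- The first violation at `k + 1` puts `k` into `X` but not into `B`.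
  obtain ⟨k, hk, hle, hlt⟩ : ∃ k, k < n ∧ countBelow X k ≤ countBelow B k ∧
      countBelow B (k + 1) < countBelow X (k + 1) := by
    have hspec := Nat.find_spec hcon
    have hmin := fun m => Nat.find_min (m := m) hcon
    rcases hT : Nat.find hcon with _ | k
    · rw [hT] at hspec
      exact absurd hspec.2 (by simp [countBelow_zero])
    · rw [hT] at hspec hmin
      have := hmin k (by omega)
      push Not at this
      exact ⟨k, hspec.1, this (by omega), hspec.2⟩
  set κ : Fin n := ⟨k, hk⟩ with hκ
  have hkX : κ ∈ X ∧ κ ∉ B := by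
    rw [countBelow_succ _ hk, countBelow_succ _ hk, ← hκ] at hlt
    split_ifs at hlt with h1 h2 h2
    · omega
    · omega
    · exact ⟨h2, h1⟩
    · omega
  have hkD : κ ∈ symmDiff X B := mem_symmDiff.2 (Or.inl hkX)
  obtain ⟨j, hj, hjk, hXj, hBj⟩ := hex X B hX hB κ hkD
  -- Otherwise `B Δ {k, j}` would have a larger weight than `B`.
  have hjB : j ∈ B ∧ j < κ := by
    have h := hmax _ hBj
    have hκB : symmDiff B {κ} = insert κ B := (insert_eq_symmDiff hkX.2).symm
    rw [hκB] at h
    have hκn : (κ.val : ℤ) < n := by exact_mod_cast κ.2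
    by_cases hjB : j ∈ B
    · refine ⟨hjB, ?_⟩
      by_contra! hle
      have hlt : (κ.val : ℤ) < j.val := by
        exact_mod_cast Fin.lt_def.1 (lt_of_le_of_ne hle hjk.symm)
      rw [← erase_eq_symmDiff (mem_insert_of_mem hjB)] at h
      have h2 := sum_erase_add (insert κ B) (fun i : Fin n => (n : ℤ) - i.val)
        (mem_insert_of_mem hjB)
      rw [sum_insert hkX.2] at h2
      linarith
    · rw [← insert_eq_symmDiff (by simp [hjk, hjB]), sum_insert (by simp [hjk, hjB]),
        sum_insert hkX.2] at h
      have : (j.val : ℤ) < n := by exact_mod_cast j.2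
      linarith
  have hjX : j ∉ X := fun h => by
    rcases mem_symmDiff.1 hj with h' | h'
    exacts [h'.2 hjB.1, h'.2 h]
  refine absurd (ih _ ?_ _ hXj rfl (k + 1) hk) (not_le.2 ?_)
  · have : symmDiff (symmDiff (symmDiff X {κ}) {j}) B = ((symmDiff X B).erase κ).erase j := by
      rw [erase_eq_symmDiff hkD, erase_eq_symmDiff (mem_symmDiff.2 (Or.inl ⟨hj, by simpa⟩)),
        symmDiff_right_comm _ _ B, symmDiff_right_comm _ _ B]
    rw [this, ← hc]
    exact (card_le_card (erase_subset _ _)).trans_lt (card_erase_lt_of_mem hkD)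
  · -- The exchange moves an element of `X` from `k` to `j < k`.
    refine hlt.trans_le (card_le_card_of_injOn (fun x => if x = κ then j else x) ?_ ?_)
    · intro x hx
      simp only [coe_filter, Set.mem_ofPred_eq, mem_symmDiff_pair X hjk] at hx ⊢
      by_cases h : x = κ
      · have := Fin.lt_def.1 hjB.2
        simp only [h, if_true, or_true]
        exact ⟨hjX, by simp only [hκ] at this; omega⟩
      · have : x ≠ j := fun h' => hjX (h' ▸ hx.1)
        simp [h, this, hx.1, hx.2]
    · intro x hx y hy hxy
      simp only [coe_filter, Set.mem_ofPred_eq] at hx hy hxy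
      have h1 : x ≠ j := fun h' => hjX (h' ▸ hx.1)
      have h2 : y ≠ j := fun h' => hjX (h' ▸ hy.1)
      split_ifs at hxy with h3 h4 h4
      · rw [h3, h4]
      · exact absurd hxy.symm h2
      · exact absurd hxy h1
      · exact hxy

/-- The simultaneous symmetric exchange axiom: in the oriented axiom for `A Δ {i}` and `B Δ {i}`
the term of `i` is non-zero, so, for the sign `w` making it positive, another term is negative. -/
theorem IsOrientedEvenDeltaMatroid.exists_exchange {n : ℕ} {p : Finset (Fin n) → SignType}
    (hp : IsOrientedEvenDeltaMatroid p) {A B : Finset (Fin n)} (hA : p A ≠ 0) (hB : p B ≠ 0)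
    {i : Fin n} (hi : i ∈ symmDiff A B) :
    ∃ j ∈ symmDiff A B, j ≠ i ∧ p (symmDiff (symmDiff A {i}) {j}) ≠ 0 ∧
      p (symmDiff (symmDiff B {i}) {j}) ≠ 0 := by
  have hD : symmDiff (symmDiff A {i}) (symmDiff B {i}) = symmDiff A B := by
    rw [symmDiff_symmDiff_symmDiff_comm, symmDiff_self, symmDiff_bot]
  set A' := symmDiff A {i} with hA'
  set B' := symmDiff B {i} with hB'
  have hAi : symmDiff A' {i} = A := by rw [hA', symmDiff_assoc, symmDiff_self, symmDiff_bot]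
  have hBi : symmDiff B' {i} = B := by rw [hB', symmDiff_assoc, symmDiff_self, symmDiff_bot]
  have hmem : ∀ j, (symmDiff A' B').orderEmbOfFin rfl j ∈ symmDiff A B := fun j => by
    rw [← hD]; exact orderEmbOfFin_mem _ _ _
  obtain ⟨j₀, hj₀⟩ : ∃ j₀, (symmDiff A' B').orderEmbOfFin rfl j₀ = i := by
    have : i ∈ Set.range ((symmDiff A' B').orderEmbOfFin rfl) := by
      rw [range_orderEmbOfFin, hD]; exact hi
    exact this
  obtain ⟨w, hw, hw1⟩ : ∃ w : SignType, (w = 1 ∨ w = -1) ∧ kappa p A' B' w j₀ = 1 := by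
    simp only [kappa, hj₀, hAi, hBi]
    have hs : (-1 : SignType) ^ (j₀.val + 1) = 1 ∨ (-1 : SignType) ^ (j₀.val + 1) = -1 :=
      neg_one_pow_eq_or _ _
    generalize (-1 : SignType) ^ (j₀.val + 1) = s at hs ⊢
    generalize p A = x at hA ⊢
    generalize p B = y at hB ⊢
    revert s x y
    decide
  have hneg : ∃ j, ¬ 0 ≤ kappa p A' B' w j := by
    by_contra! hcon
    have := hp.exchange A' B' w hw hcon j₀
    rw [hw1] at this
    exact absurd this (by decide)
  obtain ⟨j, hj⟩ := hneg
  have hjne : kappa p A' B' w j ≠ 0 := fun h => hj h.ge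
  refine ⟨_, hmem j, fun h => hj ?_, fun h => hjne ?_, fun h => hjne ?_⟩
  · have : j = j₀ := ((symmDiff A' B').orderEmbOfFin rfl).injective (h.trans hj₀.symm)
    rw [this, hw1]
    decide
  · rw [kappa, h, mul_zero, zero_mul]
  · rw [kappa, h, mul_zero]

section DnOrder

variable {n : ℕ} (a : Fin n → Ground n)

/-- The unstarred elements among the `a_i`. -/
def unstarredLabels : Finset (Fin n) := unstarred (univ.image a)

/-- The index of `a_i`, forgetting a star. -/
def label (i : Fin n) : Fin n := Sum.elim id id (a i)

/-- The admissible set containing `a_i*` for `i ∈ X` and `a_i` for `i ∉ X`. -/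
def starredAt (X : Finset (Fin n)) : AdmSet n n :=
  complete (symmDiff (X.image (label a)) (unstarredLabels a))

variable {a}

theorem label_injective (ha : Function.Injective a) (hadm : Admissible (univ.image a)) :
    Function.Injective (label a) := by
  intro i j h
  have hno : a i ≠ star (a j) := fun h' =>
    admissible_iff.1 hadm (a j) (by simp) (by rw [← h']; simp)
  refine ha ?_
  unfold label at h
  rcases hi : a i with s | s <;> rcases hj : a j with t | t <;> simp_all [star]

theorem mem_starredAt (ha : Function.Injective a) (hadm : Admissible (univ.image a))
    (X : Finset (Fin n)) (i : Fin n) : a i ∈ (starredAt a X).1 ↔ i ∉ X := by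
  have hinj := label_injective ha hadm
  have h1 : label a i ∈ X.image (label a) ↔ i ∈ X := hinj.mem_finset_image
  rcases hi : a i with t | t
  · have ht : label a i = t := by simp [label, hi]
    have h2 : t ∈ unstarredLabels a := by
      rw [unstarredLabels, ← inl_mem_iff, ← hi]; simp
    rw [inl_mem_iff, starredAt, unstarred_complete, mem_symmDiff, ← ht, h1, ht]
    tauto
  · have ht : label a i = t := by simp [label, hi]
    have h2 : t ∉ unstarredLabels a := by
      rw [unstarredLabels, ← inl_mem_iff]
      have := admissible_iff.1 hadm (a i) (by simp)
      rwa [hi] at this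
    rw [inr_mem_iff, starredAt, unstarred_complete, mem_symmDiff, ← ht, h1, ht]
    tauto

theorem star_mem_iff (B : AdmSet n n) (x : Ground n) : star x ∈ B.1 ↔ x ∉ B.1 := by
  rcases x with t | t
  · rw [inl_mem_iff]; exact inr_mem_iff B t
  · rw [inr_mem_iff, not_not]; exact inl_mem_iff B.1 t

theorem star_mem_starredAt (ha : Function.Injective a) (hadm : Admissible (univ.image a))
    (X : Finset (Fin n)) (i : Fin n) : star (a i) ∈ (starredAt a X).1 ↔ i ∈ X := by
  rw [star_mem_iff, mem_starredAt ha hadm, not_not]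

theorem exists_eq_or_eq_star (ha : Function.Injective a) (hadm : Admissible (univ.image a))
    (x : Ground n) : ∃ i, x = a i ∨ x = star (a i) := by
  obtain ⟨i, hi⟩ := Finite.surjective_of_injective (label_injective ha hadm)
    (Sum.elim id id x)
  refine ⟨i, ?_⟩
  unfold label at hi
  rcases x with s | s <;> rcases h : a i with t | t <;> simp_all [star]

theorem starredAt_surjective (ha : Function.Injective a) (hadm : Admissible (univ.image a)) :
    Function.Surjective (starredAt a) := by
  intro B
  refine ⟨univ.filter fun i => star (a i) ∈ B.1, Subtype.ext (Finset.ext fun x => ?_)⟩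
  obtain ⟨i, rfl | rfl⟩ := exists_eq_or_eq_star ha hadm x
  · rw [mem_starredAt ha hadm, mem_filter, star_mem_iff]
    simp
  · rw [star_mem_starredAt ha hadm, mem_filter]
    simp

variable (a) in
/-- The elements of `J` in the linear order `a_1 < ⋯ < a_n < a_n* < ⋯ < a_1*`, which refines the
`D_n`-admissible one. -/
def nthElement (s : Fin (2 * n)) : Ground n :=
  if h : s.val < n then a ⟨s.val, h⟩ else star (a ⟨2 * n - 1 - s.val, by omega⟩)

theorem nthElement_of_lt {s : Fin (2 * n)} (h : s.val < n) : nthElement a s = a ⟨s.val, h⟩ :=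
  dif_pos h

theorem nthElement_of_le {s : Fin (2 * n)} (h : n ≤ s.val) :
    nthElement a s = star (a ⟨2 * n - 1 - s.val, by omega⟩) :=
  dif_neg h.not_gt

theorem nthElement_surjective (ha : Function.Injective a) (hadm : Admissible (univ.image a)) :
    Function.Surjective (nthElement a) := by
  intro x
  obtain ⟨i, rfl | rfl⟩ := exists_eq_or_eq_star ha hadm x
  · exact ⟨⟨i.val, by omega⟩, nthElement_of_lt i.2⟩
  · refine ⟨⟨2 * n - 1 - i.val, by omega⟩, ?_⟩
    rw [nthElement_of_le (by simp only; omega)]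
    congr 2
    ext
    simp only
    omega

theorem nthElement_injective (ha : Function.Injective a) (hadm : Admissible (univ.image a)) :
    Function.Injective (nthElement a) :=
  ((Fintype.bijective_iff_surjective_and_card _).2
    ⟨nthElement_surjective ha hadm, by simp [two_mul]⟩).1

theorem dnLE_nthElement {s t : Fin (2 * n)} (hst : s < t) (h : ¬ (s.val + 1 = n ∧ t.val = n)) :
    dnLE a (nthElement a s) (nthElement a t) := by
  rw [Fin.lt_def] at hst
  rcases lt_or_ge t.val n with ht | ht
  · exact Or.inr (Or.inl ⟨_, _, hst, nthElement_of_lt (hst.trans ht), nthElement_of_lt ht⟩)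
  rcases lt_or_ge s.val n with hs | hs
  · exact Or.inr (Or.inr (Or.inr ⟨_, _, by simp only; omega, nthElement_of_lt hs,
      nthElement_of_le ht⟩))
  · exact Or.inr (Or.inr (Or.inl ⟨⟨2 * n - 1 - t.val, by omega⟩, ⟨2 * n - 1 - s.val, by omega⟩,
      Fin.lt_def.2 (by simp only; omega), nthElement_of_le hs, nthElement_of_le ht⟩))

variable (a) in
/-- The positions of the elements of an admissible set in the linear order of `J`. -/
def positions (X : Finset (Fin n)) : Finset (Fin (2 * n)) :=
  univ.filter fun s => nthElement a s ∈ (starredAt a X).1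

theorem mem_positions_of_lt (ha : Function.Injective a) (hadm : Admissible (univ.image a))
    (X : Finset (Fin n)) {t : ℕ} (h : t < n) (h' : t < 2 * n) :
    (⟨t, h'⟩ : Fin (2 * n)) ∈ positions a X ↔ (⟨t, h⟩ : Fin n) ∉ X := by
  rw [positions, mem_filter, nthElement_of_lt h, mem_starredAt ha hadm]
  simp

theorem mem_positions_of_le (ha : Function.Injective a) (hadm : Admissible (univ.image a))
    (X : Finset (Fin n)) {t u : ℕ} (h' : t < 2 * n) (hu : u < n) (htu : t + u + 1 = 2 * n) :
    (⟨t, h'⟩ : Fin (2 * n)) ∈ positions a X ↔ (⟨u, hu⟩ : Fin n) ∈ X := by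
  rw [positions, mem_filter, nthElement_of_le (by simp only; omega), star_mem_starredAt ha hadm]
  have : (⟨2 * n - 1 - t, by omega⟩ : Fin n) = ⟨u, hu⟩ := by ext; simp only; omega
  simp [this]

theorem image_positions (ha : Function.Injective a) (hadm : Admissible (univ.image a))
    (X : Finset (Fin n)) : (positions a X).image (nthElement a) = (starredAt a X).1 := by
  ext x
  rw [mem_image]
  constructor
  · rintro ⟨s, hs, rfl⟩
    exact (mem_filter.1 hs).2
  · intro hx
    obtain ⟨s, rfl⟩ := nthElement_surjective ha hadm x
    exact ⟨s, mem_filter.2 ⟨mem_univ _, hx⟩, rfl⟩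

theorem card_positions (ha : Function.Injective a) (hadm : Admissible (univ.image a))
    (X : Finset (Fin n)) : (positions a X).card = n := by
  rw [← card_image_of_injective _ (nthElement_injective ha hadm), image_positions ha hadm,
    (starredAt a X).2.1]

theorem countBelow_positions_of_le (ha : Function.Injective a) (hadm : Admissible (univ.image a))
    (X : Finset (Fin n)) {t : ℕ} (ht : t ≤ n) :
    countBelow (positions a X) t + countBelow X t = t := by
  induction t with
  | zero => simp [countBelow_zero]
  | succ t ih =>
    have hm := mem_positions_of_lt ha hadm X (t := t) ht (by omega)
    have := ih (by omega)
    rw [countBelow_succ _ (by omega : t < 2 * n), countBelow_succ X ht]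
    simp only [hm]
    split_ifs <;> omega

theorem countBelow_positions_of_ge (ha : Function.Injective a) (hadm : Admissible (univ.image a))
    (X : Finset (Fin n)) {u : ℕ} (hu : u ≤ n) :
    countBelow (positions a X) (2 * n - u) + countBelow X u = n := by
  induction u with
  | zero => rw [countBelow_zero, countBelow_of_le _ (by omega), card_positions ha hadm, add_zero]
  | succ u ih =>
    have hm := mem_positions_of_le ha hadm X (t := 2 * n - (u + 1)) (by omega) hu (by omega)
    have h := ih (by omega)
    have e : 2 * n - u = 2 * n - (u + 1) + 1 := by omega
    rw [e, countBelow_succ _ (by omega : 2 * n - (u + 1) < 2 * n)] at h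
    rw [countBelow_succ X hu]
    simp only [hm] at h
    split_ifs at h ⊢ <;> omega

/-- The elements of an admissible set are pairwise comparable: it does not contain both `a_n`
and `a_n*`. -/
theorem isIncreasingList_positions (ha : Function.Injective a)
    (hadm : Admissible (univ.image a)) (X : Finset (Fin n)) {r : Ground n → Ground n → Prop}
    (hr : ∀ x y, r x y ↔ dnLE a x y) :
    IsIncreasingList r (starredAt a X).1
      (nthElement a ∘ (positions a X).orderEmbOfFin (card_positions ha hadm X)) := by
  constructor
  · rw [← image_image, ← image_positions ha hadm]
    congr 1
    ext s
    simp
  · intro i j hij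
    have hlt := ((positions a X).orderEmbOfFin (card_positions ha hadm X)).strictMono hij
    refine ⟨(hr _ _).2 (dnLE_nthElement hlt ?_), fun h => hlt.ne (nthElement_injective ha hadm h)⟩
    have hi := orderEmbOfFin_mem _ (card_positions ha hadm X) i
    have hj := orderEmbOfFin_mem _ (card_positions ha hadm X) j
    generalize (positions a X).orderEmbOfFin (card_positions ha hadm X) i = s at *
    generalize (positions a X).orderEmbOfFin (card_positions ha hadm X) j = t at *
    rintro ⟨hs, ht⟩
    have hn : s.val < n := by omega
    exact (mem_positions_of_lt ha hadm X hn s.2).1 hi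
      ((mem_positions_of_le ha hadm X t.2 hn (by omega)).1 hj)

/-- Domination of initial segments gives the Gale ordering; the parity condition excludes that
`a_n` would have to be compared with `a_n*`. -/
theorem galeLE_starredAt (ha : Function.Injective a) (hadm : Admissible (univ.image a))
    {X B : Finset (Fin n)} (hle : ∀ t ≤ n, countBelow X t ≤ countBelow B t)
    (hpar : X.card ≡ B.card [MOD 2]) {r : Ground n → Ground n → Prop}
    (hr : ∀ x y, r x y ↔ dnLE a x y) : galeLE r (starredAt a X) (starredAt a B) := by
  refine ⟨_, _, isIncreasingList_positions ha hadm X hr, isIncreasingList_positions ha hadm B hr,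
    fun i => (hr _ _).2 ?_⟩
  have hcount : ∀ t ≤ 2 * n, countBelow (positions a B) t ≤ countBelow (positions a X) t := by
    intro t ht
    rcases le_total t n with h | h
    · have h1 := countBelow_positions_of_le ha hadm X h
      have h2 := countBelow_positions_of_le ha hadm B h
      have := hle t h
      omega
    · have h1 := countBelow_positions_of_ge ha hadm X (u := 2 * n - t) (by omega)
      have h2 := countBelow_positions_of_ge ha hadm B (u := 2 * n - t) (by omega)
      have := hle (2 * n - t) (by omega)
      rw [Nat.sub_sub_self ht] at h1 h2
      omega
  have hst := orderEmbOfFin_le_of_countBelow_le (card_positions ha hadm X)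
    (card_positions ha hadm B) hcount i
  have hX := countBelow_orderEmbOfFin _ (card_positions ha hadm X) i
  have hB := countBelow_orderEmbOfFin _ (card_positions ha hadm B) i
  have hmX := orderEmbOfFin_mem _ (card_positions ha hadm X) i
  simp only [Function.comp]
  generalize (positions a X).orderEmbOfFin (card_positions ha hadm X) i = s at *
  generalize (positions a B).orderEmbOfFin (card_positions ha hadm B) i = t at *
  rcases hst.eq_or_lt with rfl | hlt
  · exact Or.inl rfl
  refine dnLE_nthElement hlt ?_
  rintro ⟨hs, ht⟩
  have hn : s.val < n := by omega
  have h1 := (mem_positions_of_lt ha hadm X hn s.2).1 hmX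
  have h2 := countBelow_succ X hn
  rw [if_neg h1, hs, countBelow_of_le X le_rfl, add_zero] at h2
  have h3 := countBelow_positions_of_le ha hadm X hn.le
  have h4 := countBelow_positions_of_le ha hadm B ht.le
  rw [countBelow_of_le B ht.ge, hB] at h4
  rw [Nat.ModEq] at hpar
  omega

end DnOrder

/-- The support of an oriented even `Δ`-matroid is a Lagrangian orthogonal matroid. -/
theorem IsOrientedEvenDeltaMatroid.isOrthogonalMatroid {n : ℕ} {p : AdmSet n n → SignType}
    (hp : IsOrientedEvenDeltaMatroid (forgetStars p)) :
    IsOrthogonalMatroid {A : AdmSet n n | p A ≠ 0} := by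
  rintro r ⟨a, ha, hadm, hr⟩
  have hinj := label_injective ha hadm
  set d : Finset (Fin n) → Finset (Fin n) :=
    fun X => symmDiff (X.image (label a)) (unstarredLabels a) with hd
  have hpd : ∀ X, p (starredAt a X) = forgetStars p (d X) := fun X => rfl
  have hdD : ∀ X Y, symmDiff (d X) (d Y) = (symmDiff X Y).image (label a) := by
    intro X Y
    simp only [hd]
    rw [symmDiff_symmDiff_symmDiff_comm, symmDiff_self, symmDiff_bot, image_symmDiff _ _ hinj]
  have hdi : ∀ X i j, d (symmDiff (symmDiff X {i}) {j}) =
      symmDiff (symmDiff (d X) {label a i}) {label a j} := by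
    intro X i j
    simp only [hd]
    rw [image_symmDiff _ _ hinj, image_symmDiff _ _ hinj, image_singleton, image_singleton,
      symmDiff_right_comm _ _ (unstarredLabels a), symmDiff_right_comm _ _ (unstarredLabels a)]
  have hdom : ∃ B, p (starredAt a B) ≠ 0 ∧ ∀ X, p (starredAt a X) ≠ 0 →
      ∀ t ≤ n, countBelow X t ≤ countBelow B t := by
    refine exists_countBelow_le ?_ ?_
    · obtain ⟨S, hS⟩ := hp.nonzero
      obtain ⟨X, hX⟩ := starredAt_surjective ha hadm (complete S)
      exact ⟨X, by rw [hX]; exact hS⟩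
    · intro X Y hX hY i hi
      have hi' : label a i ∈ symmDiff (d X) (d Y) := by
        rw [hdD]; exact mem_image_of_mem _ hi
      obtain ⟨t, ht, hti, htX, htY⟩ := hp.exists_exchange hX hY hi'
      rw [hdD, mem_image] at ht
      obtain ⟨j, hj, rfl⟩ := ht
      refine ⟨j, hj, fun h => hti (h ▸ rfl), ?_, ?_⟩
      · rw [hpd, hdi]; exact htX
      · rw [hpd, hdi]; exact htY
  obtain ⟨B, hB, hle⟩ := hdom
  refine ⟨starredAt a B, hB, fun A hA => ?_⟩
  obtain ⟨X, rfl⟩ := starredAt_surjective ha hadm A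
  refine galeLE_starredAt ha hadm (hle X hA) ?_ hr
  have h := hp.even (d X) (d B) hA hB
  have h1 := card_symmDiff_add (d X) (d B)
  have h2 := card_symmDiff_add X B
  rw [hdD, card_image_of_injective _ hinj] at h1
  rw [Nat.ModEq] at h ⊢
  omega

end OrthMat

theorem mainTheorem1 (n : ℕ) (C : Matrix (Fin n) (OrthMat.Ground n) ℝ)
    (M : Set (OrthMat.AdmSet n n)) (hC : OrthMat.IsOrthogonalRepresentation C M) :
    M.Nonempty ∧
    (∀ F ∈ M,
      (∃ P : Matrix (Fin n) (Fin n) ℝ, IsUnit P ∧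
        P * OrthMat.swapColumns C (OrthMat.unstarred F.1) =
          Matrix.fromCols (OrthMat.pivotMatrix C F) 1) ∧
      (OrthMat.pivotMatrix C F).transpose = -OrthMat.pivotMatrix C F ∧
      (OrthMat.signedPivotMatrix C F).transpose = -OrthMat.signedPivotMatrix C F ∧
      OrthMat.IsOrientedOrthogonalMatroid (OrthMat.orientation C F) ∧
      {B | OrthMat.orientation C F B ≠ 0} = M) ∧
    (∀ F ∈ M, ∀ F' ∈ M,
      OrthMat.SignEquivalent (OrthMat.orientation C F) (OrthMat.orientation C F')) := by
  obtain rfl := hC.bases_eq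
  refine ⟨OrthMat.representedBases_nonempty hC, fun F hF => ⟨⟨_, ?_,
    OrthMat.inv_mul_swapColumns hF⟩, OrthMat.pivotMatrix_transpose hC hF,
    OrthMat.signedPivotMatrix_transpose hC hF, ?_, ?_⟩, fun F hF F' hF' => ?_⟩
  · rw [Matrix.isUnit_nonsing_inv_iff]
    exact OrthMat.isUnit_columns hF
  · have h := OrthMat.isOrientedEvenDeltaMatroid_orientation hC hF
    exact ⟨h.isOrthogonalMatroid, h⟩
  · ext B
    rw [Set.mem_ofPred_eq, OrthMat.orientation_eq, ← OrthMat.spinor_ne_zero_iff hC hF B, Ne,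
      sign_eq_zero_iff]
  · have hsign : ∀ B, OrthMat.orientation C F' B =
        SignType.sign (OrthMat.spinor C F' (OrthMat.unstarred F.1)) *
          OrthMat.orientation C F B := by
      intro B
      rw [OrthMat.orientation_eq, OrthMat.orientation_eq, OrthMat.spinor_eq_mul hC hF hF', sign_mul]
    have hne := (OrthMat.spinor_ne_zero_iff hC hF' F).2 hF
    rcases lt_or_gt_of_ne hne with h | h
    · exact Or.inr fun B => by rw [hsign, sign_neg h, neg_one_mul]
    · exact Or.inl fun B => by rw [hsign, sign_pos h, one_mul]
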